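/- Let $\gamma_{\mathrm{TF}}>0$ be a constant (for electrons, $\gamma_{\mathrm{TF}}=(3\pi^2)^{2/3}/2$ in Hartree units), and for $Z>0$ let $$\mathcal{E}_Z^{\mathrm{TF}}(\rho):=\int_{\mathbb{R}^3}\Bigl(\tfrac35\gamma_{\mathrm{TF}}\,\rho(x)^{5/3}-\frac{Z}{|x|}\rho(x)\Bigr)\,dx+D[\rho],\qquad D[\rho]:=\frac12\int_{\mathbb{R}^3}\int_{\mathbb{R}^3}\frac{\rho(x)\rho(y)}{|x-y|}\,dx\,dy,$$ be the Thomas--Fermi functional on $\mathcal{I}:=\{\rho\in L^{5/3}(\mathbb{R}^3)\mid \rho\ge0,\ D[\rho]<\infty\}$, and let $E^{\mathrm{TF}}(Z):=\inf\{\mathcal{E}_Z^{\mathrm{TF}}(\rho)\mid\rho\in\mathcal{I}\}$. Functions are identified when they agree almost everywhere. For every $Z>0$ the functional $\mathcal{E}_Z^{\mathrm{TF}}$ has a unique minimizer $\rho_Z$ on $\mathcal{I}$, and it has the following properties. 1. $\rho_Z$ is spherically symmetric, and decreasing and convex in the radial variable: there is a non-increasing convex function $f:(0,\infty)\to\mathbb{R}$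 with $\rho_Z(x)=f(|x|)$ for almost every $x\in\mathbb{R}^3$. 2. $\rho_Z$ is integrable and $\int_{\mathbb{R}^3}\rho_Z=Z$. 3. For almost every $x\in\mathbb{R}^3$ the convolution $(\rho_Z*|\cdot|^{-1})(x)=\int_{\mathbb{R}^3}\frac{\rho_Z(y)}{|x-y|}\,dy$ converges absolutely and the Thomas--Fermi equation holds: $$\gamma_{\mathrm{TF}}\,\rho_Z(x)^{2/3}=\frac{Z}{|x|}-(\rho_Z*|\cdot|^{-1})(x).$$ 4. $\rho_Z(x)=Z^2\rho_1(Z^{1/3}x)$ for almost every $x\in\mathbb{R}^3$, and $E^{\mathrm{TF}}(Z)=E^{\mathrm{TF}}(1)\,Z^{7/3}$. -/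

import Mathlib

open MeasureTheory

noncomputable section

namespace ThomasFermi

/-- Physical space, with the Euclidean norm and Lebesgue measure. -/
abbrev Space : Type := EuclideanSpace ℝ (Fin 3)

/-- The Coulomb energy
`D[ρ] = (1/2) ∫ dx ∫ dy ρ(x) ρ(y) / |x - y|`. -/
def coulombEnergy (ρ : Space → ℝ) : ℝ :=
  (1 / 2) * ∫ x : Space, ∫ y : Space, ρ x * ρ y / ‖x - y‖

/-- The class of admissible densities: nonnegative `L^{5/3}` functions of finite Coulomb energy.
For nonnegative `ρ`, `D[ρ] < ∞` is the integrability of `ρ(x) ρ(y) / |x - y|` over pairs. -/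
def admissible : Set (Space → ℝ) :=
  {ρ | MemLp ρ (5 / 3) volume ∧ (∀ᵐ x, 0 ≤ ρ x) ∧
    Integrable (fun p : Space × Space => ρ p.1 * ρ p.2 / ‖p.1 - p.2‖) (volume.prod volume)}

/-- The Thomas-Fermi functional of an atom of nuclear charge `Z`, with kinetic constant `γ`. -/
def tfFunctional (γ Z : ℝ) (ρ : Space → ℝ) : ℝ :=
  (∫ x : Space, (3 / 5 * γ * ρ x ^ (5 / 3 : ℝ) - Z / ‖x‖ * ρ x)) + coulombEnergy ρ

/-- The Thomas-Fermi energy, the infimum of the functional over all admissible densities. -/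
def tfEnergy (γ Z : ℝ) : ℝ :=
  sInf (tfFunctional γ Z '' admissible)

/-- `ρ` is an (unrestricted) minimizer of the Thomas-Fermi functional. -/
def IsTFMinimizer (γ Z : ℝ) (ρ : Space → ℝ) : Prop :=
  ρ ∈ admissible ∧ ∀ σ ∈ admissible, tfFunctional γ Z ρ ≤ tfFunctional γ Z σ

/-- The Coulomb kernel `|x|⁻¹`. -/
def coulombKernel (x : Space) : ℝ := ‖x‖⁻¹

/-- The Thomas-Fermi potential `φ = Z |·|⁻¹ - ρ * |·|⁻¹`. -/
def tfPotential (Z : ℝ) (ρ : Space → ℝ) (x : Space) : ℝ :=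
  Z * coulombKernel x -
    convolution ρ coulombKernel (ContinuousLinearMap.mul ℝ ℝ) volume x

end ThomasFermi

end

/-!
The minimizer is constructed explicitly, and convexity of the functional then gives its minimality
and its uniqueness together, so that no compactness argument is needed.

For a radial potential `φ = y(r) / r` the Thomas-Fermi equation becomes the boundary value problem
`y'' = c r ^ (-1/2) y ^ (3/2)`, `y 0 = Z`, `y ∞ = 0`, with `c = 4 π γ ^ (-3/2)`. It is solved by
shooting. In the variable `t = √r` the singularity at the origin disappears, and the solutions with
too steep an initial slope (which become negative) and with too flat a one (which turn upwards) form
two disjoint nonempty open sets of slopes; as an interval of slopes is connected, some solution does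
neither (`exists_global_tf_solution`), and it is convex, decreasing and tends to zero
(`exists_isTFProfile`). The density is `ρ = (φ / γ) ^ (3/2)`. Integrating the differential equation
against `r` gives `∫ ρ = Z`, and integrating it against the radial Green function
`min (1/r) (1/s)` gives, by Newton's theorem (`lintegral_radial_mul_inv_norm_sub`), the
Thomas-Fermi equation `γ ρ ^ (2/3) = Z / |x| - ρ * |·|⁻¹` (`IsTFProfile.solvesTF`).

For an admissible `σ` this equation turns the excess energy into
`E(σ) - E(ρ) = γ ∫ B(σ, ρ) + D[σ - ρ]` (`SolvesTF.tfFunctional_sub`), where `B` is the Bregman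
divergence of `(3/5) t ^ (5/3)`, nonnegative and zero only on the diagonal, and `D` is the Coulomb
energy. The latter is nonnegative because `1 / |x - y|` is a superposition of products of Gaussians
`exp (-2 s² |x - z|²) exp (-2 s² |y - z|²)` (`integral_mul_mul_inv_norm_sub_nonneg`). Hence `ρ`
minimizes, and every minimizer agrees with it almost everywhere. The scaling laws follow from
uniqueness and the change of variables `ρ ↦ a ^ 6 ρ(a x)`.
-/

open Set Filter Topology
open scoped NNReal ENNReal Pointwise

namespace ThomasFermi

/-! ### The Thomas-Fermi system as a global flow -/

/-- A time-dependent vector field that is bounded and Lipschitz, locally uniformly in time,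
has a global integral curve through every initial value. -/
theorem exists_isIntegralCurve_of_lipschitz {E : Type*} [NormedAddCommGroup E] [NormedSpace ℝ E]
    [CompleteSpace E] (f : ℝ → E → E)
    (hK : ∀ T : ℝ≥0, ∃ K : ℝ≥0, ∀ t ∈ Icc (-T : ℝ) T, LipschitzWith K (f t))
    (hL : ∀ T : ℝ≥0, ∃ L : ℝ≥0, ∀ t ∈ Icc (-T : ℝ) T, ∀ x, ‖f t x‖ ≤ L)
    (hc : ∀ x, Continuous fun t => f t x) (x₀ : E) :
    ∃ α : ℝ → E, α 0 = x₀ ∧ ∀ t, HasDerivAt α (f t (α t)) t := by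
  choose K hK using hK
  choose L hL using hL
  have key : ∀ T : ℝ≥0, ∃ α : ℝ → E, α 0 = x₀ ∧
      ∀ t ∈ Ioo (-T : ℝ) T, HasDerivAt α (f t (α t)) t := by
    intro T
    have hPL : IsPicardLindelof f (tmin := -T) (tmax := T) ⟨0, by simp⟩ x₀ (L T * T) 0 (L T)
        (K T) :=
      { lipschitzOnWith := fun t ht => (hK T t ht).lipschitzOnWith
        continuousOn := fun x _ => (hc x).continuousOn
        norm_le := fun t ht x _ => hL T t ht x
        mul_max_le := by simp }
    obtain ⟨α, h0, hα⟩ := hPL.exists_eq_forall_mem_Icc_hasDerivWithinAt₀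
    exact ⟨α, h0, fun t ht => (hα t (Ioo_subset_Icc_self ht)).hasDerivAt (Icc_mem_nhds ht.1 ht.2)⟩
  choose α h0 hα using key
  -- Local solutions agree on common intervals, so they glue: at time `t` the one on
  -- `(-(|t| + 1), |t| + 1)` is used.
  have agree : ∀ S T : ℝ≥0, S ≤ T → EqOn (α S) (α T) (Ioo (-S : ℝ) S) := by
    intro S T hST
    rcases eq_or_lt_of_le (zero_le (a := S)) with rfl | hS
    · intro t ht; simp at ht
    have hST' : (S : ℝ) ≤ T := by exact_mod_cast hST
    refine ODE_solution_unique_of_mem_Ioo (v := f) (s := fun _ => univ) (K := K S) (t₀ := 0)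
      (fun t ht => (hK S t (Ioo_subset_Icc_self ht)).lipschitzOnWith) (by simpa using hS)
      (fun t ht => ⟨hα S t ht, mem_univ _⟩)
      (fun t ht => ⟨hα T t ⟨by linarith [ht.1], by linarith [ht.2]⟩, mem_univ _⟩) (by rw [h0, h0])
  let N : ℝ → ℝ≥0 := fun t => ⟨|t| + 1, by positivity⟩
  refine ⟨fun t => α (N t) t, h0 _, fun t => ?_⟩
  let T : ℝ≥0 := ⟨|t| + 2, by positivity⟩
  have hT : (T : ℝ) = |t| + 2 := rfl
  have ht := abs_le.1 (le_refl |t|)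
  have hmem : Ioo (t - 1) (t + 1) ∈ 𝓝 t := Ioo_mem_nhds (by linarith) (by linarith)
  have heq : ∀ s ∈ Ioo (t - 1) (t + 1), α (N s) s = α T s := by
    intro s hs
    have hs' : |s| ≤ |t| + 1 := abs_le.2 ⟨by linarith [hs.1], by linarith [hs.2]⟩
    refine agree (N s) T ?_ ?_
    · change |s| + 1 ≤ |t| + 2; linarith
    · change s ∈ Ioo (-(|s| + 1)) (|s| + 1)
      have := abs_le.1 (le_refl |s|)
      exact ⟨by linarith, by linarith⟩
  have h1 : HasDerivAt (α T) (f t (α T t)) t :=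
    hα T t ⟨by rw [hT]; linarith, by rw [hT]; linarith⟩
  beta_reduce
  rw [heq t (mem_of_mem_nhds hmem)]
  exact h1.congr_of_eventuallyEq (by filter_upwards [hmem] with s hs using heq s hs)

/-- The power `u ^ (3/2)`, with `u` first clamped to `[0, Z]`. -/
noncomputable def clampedPow (Z u : ℝ) : ℝ := (max 0 (min u Z)) ^ (3 / 2 : ℝ)

theorem clampedPow_nonneg (Z u : ℝ) : 0 ≤ clampedPow Z u := by
  unfold clampedPow; positivity

theorem clampedPow_le {Z : ℝ} (hZ : 0 ≤ Z) (u : ℝ) : clampedPow Z u ≤ Z ^ (3 / 2 : ℝ) := by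
  unfold clampedPow
  gcongr
  simp [hZ]

theorem clampedPow_of_nonpos {Z u : ℝ} (hu : u ≤ 0) : clampedPow Z u = 0 := by
  unfold clampedPow
  rw [max_eq_left (min_le_of_left_le hu)]
  norm_num

theorem clampedPow_of_mem {Z u : ℝ} (h0 : 0 ≤ u) (hu : u ≤ Z) :
    clampedPow Z u = u ^ (3 / 2 : ℝ) := by
  unfold clampedPow
  rw [min_eq_left hu, max_eq_right h0]

theorem exists_lipschitzWith_clampedPow {Z : ℝ} (hZ : 0 ≤ Z) :
    ∃ K : ℝ≥0, LipschitzWith K (clampedPow Z) := by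
  have h1 : LipschitzOnWith (Real.toNNReal (3 / 2 * Z ^ (1 / 2 : ℝ)))
      (fun u : ℝ => u ^ (3 / 2 : ℝ)) (Icc 0 Z) := by
    refine (convex_Icc 0 Z).lipschitzOnWith_of_nnnorm_hasDerivWithin_le
      (f' := fun u : ℝ => (3 / 2) * u ^ (1 / 2 : ℝ)) (fun u hu => ?_) (fun u hu => ?_)
    · have := (Real.hasDerivAt_rpow_const (x := u) (p := 3 / 2) (Or.inr (by norm_num)))
      norm_num at this
      norm_num
      exact this.hasDerivWithinAt
    · rw [← NNReal.coe_le_coe, coe_nnnorm, Real.coe_toNNReal _ (by positivity), Real.norm_eq_abs,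
        abs_of_nonneg (by have := hu.1; positivity)]
      have := hu.1
      gcongr
      exact hu.2
  have h2 : LipschitzWith 1 (fun u : ℝ => max 0 (min u Z)) :=
    (LipschitzWith.id.min_const Z).const_max 0
  refine ⟨_, (lipschitzOnWith_univ.1 (h1.comp h2.lipschitzOnWith (fun u _ => ?_)))⟩
  exact ⟨le_max_left _ _, max_le hZ (min_le_right _ _)⟩

/-- The Thomas-Fermi equation `y'' = c x ^ (-1/2) y ^ (3/2)` as a first-order system for `(y, y')`
in the variable `t = √x`, which removes the singularity at the origin. The values of `y` and `y'`
are clamped to `[0, Z]` and `[-M, 0]`, which makes the field bounded and Lipschitz. -/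
noncomputable def tfField (c Z M t : ℝ) (p : ℝ × ℝ) : ℝ × ℝ :=
  (2 * t * max (-M) (min p.2 0), 2 * c * clampedPow Z p.1)

theorem exists_lipschitzWith_tfField {c Z M : ℝ} (hZ : 0 ≤ Z) (T : ℝ≥0) :
    ∃ K : ℝ≥0, ∀ t ∈ Icc (-T : ℝ) T, LipschitzWith K (tfField c Z M t) := by
  obtain ⟨K, hK⟩ := exists_lipschitzWith_clampedPow hZ
  refine ⟨max (2 * T) (‖2 * c‖₊ * K), fun t ht => ?_⟩
  have h2 : LipschitzWith 1 (fun u : ℝ => max (-M) (min u 0)) :=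
    (LipschitzWith.id.min_const 0).const_max (-M)
  refine LipschitzWith.prodMk ?_ ?_
  · refine LipschitzWith.of_dist_le_mul fun p q => ?_
    have h3 := h2.dist_le_mul p.2 q.2
    have h4 : dist p.2 q.2 ≤ dist p q := le_max_right _ _
    rw [Real.dist_eq, ← mul_sub, abs_mul]
    rw [Real.dist_eq] at h3
    have h5 : |2 * t| ≤ 2 * T := by rw [abs_mul, abs_two]; gcongr; exact abs_le.2 ht
    simp only [NNReal.coe_one, one_mul] at h3
    push_cast
    exact mul_le_mul h5 (h3.trans h4) (abs_nonneg _) (by positivity)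
  · refine LipschitzWith.of_dist_le_mul fun p q => ?_
    have h3 := hK.dist_le_mul p.1 q.1
    have h4 : dist p.1 q.1 ≤ dist p q := le_max_left _ _
    rw [Real.dist_eq, ← mul_sub, abs_mul]
    rw [Real.dist_eq] at h3
    push_cast
    rw [Real.norm_eq_abs, mul_assoc]
    gcongr
    exact h3.trans (by gcongr)

theorem exists_norm_tfField_le {c Z M : ℝ} (hZ : 0 ≤ Z) (hM : 0 ≤ M) (T : ℝ≥0) :
    ∃ L : ℝ≥0, ∀ t ∈ Icc (-T : ℝ) T, ∀ p, ‖tfField c Z M t p‖ ≤ L := by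
  refine ⟨max (2 * T * M.toNNReal) (‖2 * c‖₊ * (Z ^ (3 / 2 : ℝ)).toNNReal), fun t ht p => ?_⟩
  rw [tfField, Prod.norm_mk, NNReal.coe_max]
  refine max_le_max ?_ ?_
  · have h5 : |2 * t| ≤ 2 * T := by rw [abs_mul, abs_two]; gcongr; exact abs_le.2 ht
    push_cast
    rw [Real.coe_toNNReal _ hM, Real.norm_eq_abs, abs_mul]
    gcongr
    rw [abs_le]
    exact ⟨le_max_left _ _, (max_le (by linarith) (min_le_right _ _)).trans hM⟩
  · push_cast
    rw [Real.coe_toNNReal _ (by positivity), norm_mul, Real.norm_of_nonneg (clampedPow_nonneg _ _)]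
    gcongr
    exact clampedPow_le hZ _

theorem exists_tfField_solution {c Z M : ℝ} (hZ : 0 ≤ Z) (hM : 0 ≤ M) (p : ℝ × ℝ) :
    ∃ α : ℝ → ℝ × ℝ, α 0 = p ∧ ∀ t, HasDerivAt α (tfField c Z M t (α t)) t :=
  exists_isIntegralCurve_of_lipschitz _ (exists_lipschitzWith_tfField hZ)
    (exists_norm_tfField_le hZ hM) (fun x => by unfold tfField; fun_prop) p

/-- The solution depends continuously on its initial value. -/
theorem continuous_tfField_solution {c Z M : ℝ} (hZ : 0 ≤ Z)
    {α : ℝ → ℝ → ℝ × ℝ} (h0 : ∀ b, α b 0 = (Z, -b))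
    (hα : ∀ b t, HasDerivAt (α b) (tfField c Z M t (α b t)) t) {t : ℝ} (ht : 0 ≤ t) :
    Continuous fun b => α b t := by
  obtain ⟨K, hK⟩ := exists_lipschitzWith_tfField (c := c) (M := M) hZ ⟨t, ht⟩
  refine LipschitzWith.continuous (K := ⟨Real.exp (K * t), by positivity⟩)
    (LipschitzWith.of_dist_le_mul fun b b' => ?_)
  have hcont : ∀ b, ContinuousOn (α b) (Icc 0 t) := fun b =>
    (continuous_iff_continuousAt.2 fun s => (hα b s).continuousAt).continuousOn
  have := dist_le_of_trajectories_ODE_of_mem (v := tfField c Z M) (s := fun _ => univ) (K := K)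
    (a := 0) (b := t) (f := α b) (g := α b') (δ := dist b b')
    (fun s hs => (hK s ⟨by have := hs.1; simp; linarith, hs.2.le⟩).lipschitzOnWith)
    (hcont b) (fun s _ => (hα b s).hasDerivWithinAt) (fun _ _ => mem_univ _)
    (hcont b') (fun s _ => (hα b' s).hasDerivWithinAt) (fun _ _ => mem_univ _)
    (by rw [h0, h0, Prod.dist_eq]; simp) t ⟨ht, le_rfl⟩
  simpa [mul_comm] using! this

/-! ### Shooting for the radial boundary value problem -/

/-- Shooting: for a suitable initial slope the solution of the Thomas-Fermi system, in the variable
`t = √x`, stays nonnegative and nonincreasing for all time. The slopes for which the solution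
becomes negative and those for which it starts to increase form disjoint nonempty open sets, which
cannot cover an interval. -/
theorem exists_global_tf_solution {c Z : ℝ} (hc : 0 < c) (hZ : 0 < Z) :
    ∃ Y V : ℝ → ℝ, Y 0 = Z ∧ Continuous Y ∧ Continuous V ∧
      (∀ t, 0 ≤ t → 0 ≤ Y t ∧ V t ≤ 0 ∧ HasDerivAt Y (2 * t * V t) t ∧
        HasDerivAt V (2 * c * Y t ^ (3 / 2 : ℝ)) t) := by
  -- With initial slope `-M` one has `V ≤ -(Z + 1)` on `[0, 1]`, and so `Y 1 ≤ -1`.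
  set M : ℝ := 2 * c * Z ^ (3 / 2 : ℝ) + Z + 1 with hMdef
  have hM : 0 ≤ M := by positivity
  choose α h0 hα using fun b : ℝ =>
    exists_tfField_solution (c := c) (M := M) hZ.le hM ((Z, -b) : ℝ × ℝ)
  have hY : ∀ b t, HasDerivAt (fun t => (α b t).1) (2 * t * max (-M) (min (α b t).2 0)) t :=
    fun b t => (hα b t).fst
  have hV : ∀ b t, HasDerivAt (fun t => (α b t).2) (2 * c * clampedPow Z (α b t).1) t :=
    fun b t => (hα b t).snd
  have hYc : ∀ b, Continuous fun t => (α b t).1 :=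
    fun b => continuous_iff_continuousAt.2 fun t => (hY b t).continuousAt
  have hVc : ∀ b, Continuous fun t => (α b t).2 :=
    fun b => continuous_iff_continuousAt.2 fun t => (hV b t).continuousAt
  have hVmono : ∀ b, Monotone fun t => (α b t).2 := fun b =>
    monotone_of_hasDerivAt_nonneg (hV b)
      (fun t => mul_nonneg (by positivity) (clampedPow_nonneg _ _))
  have hYanti : ∀ b, AntitoneOn (fun t => (α b t).1) (Ici 0) := fun b => by
    refine antitoneOn_of_hasDerivWithinAt_nonpos (convex_Ici 0) (hYc b).continuousOn
      (fun t _ => (hY b t).hasDerivWithinAt) (fun t ht => ?_)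
    rw [interior_Ici] at ht
    exact mul_nonpos_of_nonneg_of_nonpos (by have : 0 < t := ht; positivity)
      (max_le (by linarith) (min_le_right _ _))
  let A : Set ℝ := {b | ∃ t, 0 ≤ t ∧ (α b t).1 < 0}
  let B : Set ℝ := {b | ∃ t, 0 ≤ t ∧ 0 < (α b t).2}
  have hA : IsOpen A := by
    have : A = ⋃ t ∈ Ici (0 : ℝ), {b | (α b t).1 < 0} := by ext; simp [A]
    rw [this]
    exact isOpen_biUnion fun t ht => isOpen_lt
      (continuous_fst.comp (continuous_tfField_solution hZ.le h0 hα ht)) continuous_const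
  have hB : IsOpen B := by
    have : B = ⋃ t ∈ Ici (0 : ℝ), {b | 0 < (α b t).2} := by ext; simp [B]
    rw [this]
    exact isOpen_biUnion fun t ht => isOpen_lt continuous_const
      (continuous_snd.comp (continuous_tfField_solution hZ.le h0 hα ht))
  -- Once `V ≥ 0`, the clamped field freezes `Y`.
  have hfreeze : ∀ b s T, 0 ≤ (α b s).2 → s ≤ T → (α b T).1 = (α b s).1 := by
    intro b s T hs hsT
    refine (constant_of_has_deriv_right_zero (a := s) (b := T) (hYc b).continuousOn
      (fun t ht => ?_) T ⟨hsT, le_rfl⟩)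
    have h1 : 0 ≤ (α b t).2 := hs.trans (hVmono b ht.1)
    have h2 := (hY b t).hasDerivWithinAt (s := Ici t)
    rwa [min_eq_right h1, max_eq_right (by linarith), mul_zero] at h2
  -- If `Y < 0 < V` at time `T`, then after a zero `t₀` of `Y`, `V` is constant (its source
  -- vanishes for `Y ≤ 0`), hence positive, hence `Y` is constant: a contradiction.
  have hdisj : A ∩ B = ∅ := by
    refine eq_empty_of_forall_notMem ?_
    rintro b ⟨⟨t₁, ht₁, hY₁⟩, ⟨t₂, ht₂, hV₂⟩⟩
    set T := max t₁ t₂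
    have hT : 0 ≤ T := ht₁.trans (le_max_left _ _)
    have hYT : (α b T).1 < 0 := (hYanti b ht₁ hT (le_max_left _ _)).trans_lt hY₁
    have hVT : 0 < (α b T).2 := hV₂.trans_le (hVmono b (le_max_right _ _))
    obtain ⟨t₀, ht₀, hY₀⟩ : (0 : ℝ) ∈ (fun t => (α b t).1) '' Icc 0 T :=
      intermediate_value_Icc' hT (hYc b).continuousOn ⟨hYT.le, by simp [h0, hZ.le]⟩
    have hconst : (α b T).2 = (α b t₀).2 := by
      refine (constant_of_has_deriv_right_zero (a := t₀) (b := T) (hVc b).continuousOn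
        (fun t ht => ?_) T ⟨ht₀.2, le_rfl⟩)
      have h1 : (α b t).1 ≤ 0 :=
        (hYanti b ht₀.1 (ht₀.1.trans ht.1 : (0 : ℝ) ≤ t) ht.1).trans_eq hY₀
      have h2 := (hV b t).hasDerivWithinAt (s := Ici t)
      rwa [clampedPow_of_nonpos h1, mul_zero] at h2
    have := hfreeze b t₀ T (by rw [← hconst]; exact hVT.le) ht₀.2
    have hY₀' : (α b t₀).1 = 0 := hY₀
    linarith
  -- With initial slope `0`, `Y` stays equal to `Z` and `V` increases at a constant rate.
  have h0B : (0 : ℝ) ∈ B := by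
    refine ⟨1, zero_le_one, ?_⟩
    obtain ⟨ξ, hξ, hξ'⟩ := exists_hasDerivAt_eq_slope (fun t => (α 0 t).2) _ zero_lt_one
      (hVc 0).continuousOn (fun t _ => hV 0 t)
    have h1 : (α 0 ξ).1 = Z := by
      rw [hfreeze 0 0 ξ (by simp [h0]) hξ.1.le, h0]
    rw [h1, clampedPow_of_mem hZ.le le_rfl, h0] at hξ'
    norm_num at hξ'
    rw [← hξ']
    positivity
  have hMA : M ∈ A := by
    refine ⟨1, zero_le_one, ?_⟩
    have hVle : ∀ t ∈ Icc (0 : ℝ) 1, (α M t).2 ≤ -(Z + 1) := by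
      intro t ht
      have h1 : AntitoneOn (fun t => (α M t).2 - 2 * c * Z ^ (3 / 2 : ℝ) * t) (Icc 0 1) := by
        refine antitoneOn_of_hasDerivWithinAt_nonpos (convex_Icc 0 1)
          (f' := fun t => 2 * c * clampedPow Z (α M t).1 - 2 * c * Z ^ (3 / 2 : ℝ) * 1)
          ((hVc M).sub (by fun_prop)).continuousOn
          (fun t _ => ((hV M t).sub ((hasDerivAt_id t).const_mul _)).hasDerivWithinAt)
          (fun t _ => ?_)
        have := clampedPow_le hZ.le (α M t).1
        have : 2 * c * clampedPow Z (α M t).1 ≤ 2 * c * Z ^ (3 / 2 : ℝ) := by gcongr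
        linarith
      have h2 := h1 (left_mem_Icc.2 zero_le_one) ht ht.1
      have h3 : 2 * c * Z ^ (3 / 2 : ℝ) * t ≤ 2 * c * Z ^ (3 / 2 : ℝ) :=
        mul_le_of_le_one_right (by positivity) ht.2
      simp only [h0, mul_zero, sub_zero] at h2
      linarith
    have h1 : AntitoneOn (fun t => (α M t).1 + (Z + 1) * t ^ 2) (Icc 0 1) := by
      refine antitoneOn_of_hasDerivWithinAt_nonpos (convex_Icc 0 1)
        (f' := fun t => 2 * t * max (-M) (min (α M t).2 0) + (Z + 1) * (2 * t))
        ((hYc M).add (by fun_prop)).continuousOn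
        (fun t _ => ((hY M t).add
          (((hasDerivAt_pow 2 t).const_mul _).congr_deriv (by simp))).hasDerivWithinAt)
        (fun t ht => ?_)
      rw [interior_Icc] at ht
      have h2 := hVle t (Ioo_subset_Icc_self ht)
      have h3 : max (-M) (min (α M t).2 0) ≤ -(Z + 1) :=
        max_le (by have : 0 < 2 * c * Z ^ (3 / 2 : ℝ) := by positivity
                   linarith) ((min_le_left _ _).trans h2)
      have := mul_le_mul_of_nonneg_left h3 (by linarith [ht.1] : 0 ≤ 2 * t)
      linarith
    have h2 := h1 (left_mem_Icc.2 zero_le_one) (right_mem_Icc.2 zero_le_one) zero_le_one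
    simp only [h0] at h2
    norm_num at h2
    linarith
  obtain ⟨b, hb, hbA, hbB⟩ : ∃ b ∈ Icc 0 M, b ∉ A ∧ b ∉ B := by
    by_contra! hcon
    obtain ⟨x, -, hx⟩ := isPreconnected_Icc A B hA hB
      (fun b hb => or_iff_not_imp_left.2 (hcon b hb))
      ⟨M, right_mem_Icc.2 hM, hMA⟩ ⟨0, left_mem_Icc.2 hM, h0B⟩
    rw [hdisj] at hx
    exact hx
  have hYnn : ∀ t, 0 ≤ t → 0 ≤ (α b t).1 := fun t ht => by
    by_contra! h; exact hbA ⟨t, ht, h⟩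
  have hVnp : ∀ t, 0 ≤ t → (α b t).2 ≤ 0 := fun t ht => by
    by_contra! h; exact hbB ⟨t, ht, h⟩
  refine ⟨fun t => (α b t).1, fun t => (α b t).2, by simp [h0], hYc b, hVc b, fun t ht =>
    ⟨hYnn t ht, hVnp t ht, ?_, ?_⟩⟩
  · have h1 := hY b t
    have h2 : -M ≤ (α b t).2 := by
      have h3 := hVmono b ht
      simp only [h0] at h3
      linarith [hb.2]
    rwa [min_eq_left (hVnp t ht), max_eq_right h2] at h1
  · have h1 := hV b t
    have h2 : (α b t).1 ≤ Z := by simpa [h0] using hYanti b self_mem_Ici ht ht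
    rwa [clampedPow_of_mem (hYnn t ht) h2] at h1

/-- `y` solves the Thomas-Fermi boundary value problem `y'' = c x ^ (-1/2) y ^ (3/2)` on `(0, ∞)`,
`y 0 = Z`, `y ∞ = 0`, and `v = y'`. Only the values on `[0, ∞)` matter; the extension to negative
arguments is by constants, which makes both functions continuous and `y` antitone on all of `ℝ`. -/
structure IsTFProfile (c Z : ℝ) (y v : ℝ → ℝ) : Prop where
  zero : y 0 = Z
  continuous : Continuous y
  continuous_deriv : Continuous v
  nonneg : ∀ x, 0 ≤ y x
  deriv_nonpos : ∀ x, v x ≤ 0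
  antitone : Antitone y
  hasDerivAt : ∀ x, 0 < x → HasDerivAt y (v x) x
  hasDerivAt_deriv : ∀ x, 0 < x → HasDerivAt v (c * y x ^ (3 / 2 : ℝ) / √x) x
  tendsto : Tendsto y atTop (𝓝 0)

theorem exists_isTFProfile {c Z : ℝ} (hc : 0 < c) (hZ : 0 < Z) :
    ∃ y v : ℝ → ℝ, IsTFProfile c Z y v := by
  obtain ⟨Y, V, hY0, hYc, hVc, h⟩ := exists_global_tf_solution hc hZ
  have hanti : AntitoneOn Y (Ici 0) := by
    refine antitoneOn_of_hasDerivWithinAt_nonpos (convex_Ici 0) hYc.continuousOn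
      (f' := fun t => 2 * t * V t) (fun t ht => ?_) (fun t ht => ?_) <;> rw [interior_Ici] at ht
    · exact (h t (le_of_lt ht)).2.2.1.hasDerivWithinAt
    · have ht' : 0 < t := ht
      exact mul_nonpos_of_nonneg_of_nonpos (by positivity) (h t ht'.le).2.1
  have hy : Antitone fun x => Y √x := fun a b hab =>
    hanti (Real.sqrt_nonneg a) (Real.sqrt_nonneg b) (Real.sqrt_le_sqrt hab)
  have hnn : ∀ x, 0 ≤ Y √x := fun x => (h _ (Real.sqrt_nonneg x)).1
  refine ⟨fun x => Y √x, fun x => V √x, by simp [hY0], by fun_prop, by fun_prop, hnn,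
    fun x => (h _ (Real.sqrt_nonneg x)).2.1, hy, fun x hx => ?_, fun x hx => ?_, ?_⟩
  · have h1 := (h _ (Real.sqrt_nonneg x)).2.2.1.comp x (Real.hasDerivAt_sqrt hx.ne')
    refine h1.congr_deriv ?_
    have := Real.sqrt_pos.2 hx
    field_simp
  · have h1 := (h _ (Real.sqrt_nonneg x)).2.2.2.comp x (Real.hasDerivAt_sqrt hx.ne')
    refine h1.congr_deriv ?_
    have := Real.sqrt_pos.2 hx
    field_simp
  · have hbdd : BddBelow (range fun x => Y √x) := ⟨0, by rintro _ ⟨x, rfl⟩; exact hnn x⟩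
    have hlim := tendsto_atTop_ciInf hy hbdd
    set l := ⨅ x, Y √x
    have hl : 0 ≤ l := le_ciInf hnn
    rcases eq_or_lt_of_le hl with hl0 | hl0
    · rwa [← hl0] at hlim
    -- A positive limit would make `V` grow linearly in `t = √x`.
    exfalso
    have hYl : ∀ t, 0 ≤ t → l ≤ Y t := fun t ht => by
      have := ciInf_le hbdd (t ^ 2)
      simp only [Real.sqrt_sq ht] at this
      exact this
    set k := 2 * c * l ^ (3 / 2 : ℝ) with hk
    have hk0 : 0 < k := by positivity
    have hmono : MonotoneOn (fun t => V t - k * t) (Ici 0) := by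
      refine monotoneOn_of_hasDerivWithinAt_nonneg (convex_Ici 0)
        (f' := fun t => 2 * c * Y t ^ (3 / 2 : ℝ) - k * 1) (hVc.sub (by fun_prop)).continuousOn
        (fun t ht => ?_) (fun t ht => ?_) <;> rw [interior_Ici] at ht
      · exact ((h t (le_of_lt ht)).2.2.2.sub ((hasDerivAt_id t).const_mul _)).hasDerivWithinAt
      · have : k ≤ 2 * c * Y t ^ (3 / 2 : ℝ) := by
          rw [hk]; gcongr; exact hYl t (le_of_lt ht)
        linarith
    have h1 : (0 : ℝ) ≤ (1 - V 0) / k := div_nonneg (by linarith [(h 0 le_rfl).2.1]) hk0.le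
    have h2 := hmono self_mem_Ici h1 h1
    have h3 := (h _ h1).2.1
    have h4 : k * ((1 - V 0) / k) = 1 - V 0 := by field_simp
    simp only [mul_zero, h4] at h2
    linarith

namespace IsTFProfile

variable {c Z : ℝ} {y v : ℝ → ℝ}

theorem le (h : IsTFProfile c Z y v) {x : ℝ} (hx : 0 ≤ x) : y x ≤ Z := by
  rw [← h.zero]; exact h.antitone hx

theorem monotoneOn_deriv (h : IsTFProfile c Z y v) (hc : 0 ≤ c) : MonotoneOn v (Ici 0) := by
  refine monotoneOn_of_hasDerivWithinAt_nonneg (convex_Ici 0) h.continuous_deriv.continuousOn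
    (f' := fun x => c * y x ^ (3 / 2 : ℝ) / √x) (fun x hx => ?_) (fun x hx => ?_)
  · rw [interior_Ici] at hx; exact (h.hasDerivAt_deriv x hx).hasDerivWithinAt
  · have := h.nonneg x; positivity

/-- By convexity `-x y'(x) ≤ 2 (y (x/2) - y x)`. This decay is what makes the atom neutral: there is
no boundary term at infinity in `∫ x y''`. -/
theorem tendsto_mul_deriv (h : IsTFProfile c Z y v) (hc : 0 ≤ c) :
    Tendsto (fun x => x * v x) atTop (𝓝 0) := by
  have h1 : Tendsto (fun x => -(2 * y (x / 2))) atTop (𝓝 0) := by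
    have := ((h.tendsto.comp (tendsto_id.atTop_div_const (zero_lt_two' ℝ))).const_mul 2).neg
    simpa using this
  refine tendsto_of_tendsto_of_tendsto_of_le_of_le' h1 tendsto_const_nhds ?_ ?_
  · filter_upwards [eventually_gt_atTop 0] with x hx
    obtain ⟨ξ, hξ, hξ'⟩ := exists_hasDerivAt_eq_slope y v (half_lt_self hx)
      h.continuous.continuousOn (fun t ht => h.hasDerivAt t (by linarith [ht.1]))
    have h2 : v ξ ≤ v x := h.monotoneOn_deriv hc (show 0 ≤ ξ by linarith [hξ.1]) hx.le hξ.2.le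
    rw [hξ', div_le_iff₀ (by linarith)] at h2
    have := h.nonneg x
    nlinarith
  · filter_upwards [eventually_gt_atTop 0] with x hx
    exact mul_nonpos_of_nonneg_of_nonpos hx.le (h.deriv_nonpos x)

theorem tendsto_deriv (h : IsTFProfile c Z y v) (hc : 0 ≤ c) : Tendsto v atTop (𝓝 0) := by
  have := (h.tendsto_mul_deriv hc).mul (tendsto_inv_atTop_zero (𝕜 := ℝ))
  rw [mul_zero] at this
  refine this.congr' ?_
  filter_upwards [eventually_gt_atTop 0] with x hx
  field_simp

end IsTFProfile

/-! ### Newton's theorem -/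

theorem norm_vec3 (z a b : ℝ) : ‖(!₂[z, a, b] : Space)‖ = √(z ^ 2 + (a ^ 2 + b ^ 2)) := by
  rw [EuclideanSpace.norm_eq]
  simp [Fin.sum_univ_three, add_assoc]

/-- Fubini in Cartesian coordinates, with the first coordinate singled out. -/
theorem lintegral_space_eq (F : Space → ℝ≥0∞) (hF : Measurable F) :
    ∫⁻ y, F y = ∫⁻ z : ℝ, ∫⁻ p : ℝ × ℝ, F !₂[z, p.1, p.2] := by
  have h1 := (volume_preserving_piFinSuccAbove (fun _ : Fin 3 => ℝ) 0).symm
  have h2 := (volume_preserving_finTwoArrow ℝ).symm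
  have hF' : Measurable fun p : Fin 3 → ℝ => F (WithLp.toLp 2 p) := by fun_prop
  have hF'' := hF'.comp (MeasurableEquiv.piFinSuccAbove (fun _ : Fin 3 => ℝ) 0).symm.measurable
  rw [← (PiLp.volume_preserving_toLp (Fin 3)).lintegral_comp hF, ← h1.lintegral_comp hF',
    Measure.volume_eq_prod]
  refine (lintegral_prod _ hF''.aemeasurable).trans ?_
  refine lintegral_congr fun z => ?_
  refine (h2.lintegral_comp (hF''.comp measurable_prodMk_left)).symm.trans ?_
  refine lintegral_congr fun p => ?_
  simp only [Function.comp_apply]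
  congr 2
  ext i
  fin_cases i <;> rfl

/-- Integration of a rotation-invariant function over the plane `{z} × ℝ²` in terms of the
distance to the origin. -/
theorem lintegral_plane_radial (z : ℝ) {H : ℝ → ℝ≥0∞} (hH : Measurable H) :
    ∫⁻ p : ℝ × ℝ, H (√(z ^ 2 + (p.1 ^ 2 + p.2 ^ 2))) =
      ENNReal.ofReal (2 * Real.pi) * ∫⁻ s in Ioi |z|, ENNReal.ofReal s * H s := by
  have himg : (fun r => √(z ^ 2 + r ^ 2)) '' Ioi 0 = Ioi |z| := by
    ext s
    constructor
    · rintro ⟨r, hr, rfl⟩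
      have hr' : 0 < r := hr
      exact Real.lt_sqrt_of_sq_lt (by rw [sq_abs]; nlinarith)
    · intro hs
      have hs' : |z| < s := hs
      have h1 : z ^ 2 < s ^ 2 := by rw [← sq_abs z]; gcongr
      refine ⟨√(s ^ 2 - z ^ 2), Real.sqrt_pos.2 (by linarith), ?_⟩
      simp only
      rw [Real.sq_sqrt (by linarith), add_sub_cancel, Real.sqrt_sq ((abs_nonneg z).trans hs'.le)]
  have hpos : ∀ r ∈ Ioi (0 : ℝ), 0 < z ^ 2 + r ^ 2 := fun r hr => by
    have : 0 < r := hr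
    positivity
  rw [← himg, lintegral_image_eq_lintegral_abs_deriv_mul (f' := fun r => r / √(z ^ 2 + r ^ 2))
    measurableSet_Ioi (fun r hr => ?_) (fun r hr t ht h => ?_)]
  · rw [← lintegral_comp_polarCoord_symm]
    have : ∀ p : ℝ × ℝ, p ∈ polarCoord.target →
        ENNReal.ofReal p.1 • H (√(z ^ 2 + ((polarCoord.symm p).1 ^ 2 + (polarCoord.symm p).2 ^ 2)))
        = ENNReal.ofReal p.1 * H (√(z ^ 2 + p.1 ^ 2)) := by
      intro p _
      rw [smul_eq_mul, polarCoord_symm_apply]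
      congr 4
      simp only
      linear_combination p.1 ^ 2 * Real.sin_sq_add_cos_sq p.2
    rw [setLIntegral_congr_fun polarCoord.open_target.measurableSet this, polarCoord_target,
      Measure.volume_eq_prod, ← Measure.prod_restrict]
    have h1 := lintegral_prod_mul (μ := volume.restrict (Ioi (0 : ℝ)))
      (ν := volume.restrict (Ioo (-Real.pi) Real.pi))
      (f := fun r => ENNReal.ofReal r * H (√(z ^ 2 + r ^ 2))) (g := fun _ => 1) (by fun_prop)
      (by fun_prop)
    simp only [mul_one, lintegral_const, one_mul, Measure.restrict_apply_univ, Real.volume_Ioo,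
      sub_neg_eq_add, ← two_mul] at h1
    rw [h1, mul_comm]
    congr 1
    refine setLIntegral_congr_fun measurableSet_Ioi fun r hr => ?_
    have hr' : 0 < r := hr
    have h2 := Real.sqrt_pos.2 (hpos r hr)
    rw [← mul_assoc, ← ENNReal.ofReal_mul (by positivity), abs_of_nonneg (by positivity),
      div_mul_cancel₀ _ h2.ne']
  · have h1 : HasDerivAt (fun r => z ^ 2 + r ^ 2) (2 * r) r := by
      simpa using (hasDerivAt_pow 2 r).const_add (z ^ 2)
    refine ((h1.sqrt (hpos r hr).ne').congr_deriv ?_).hasDerivWithinAt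
    field_simp
  · have h1 := (Real.sqrt_inj (hpos r hr).le (hpos t ht).le).1 h
    exact (pow_left_inj₀ (le_of_lt hr) (le_of_lt ht) two_ne_zero).1 (by linarith)

/-- Up to normalization, the potential at distance `a` from the centre of a sphere of radius `s`, as
an integral over the height `z`, in which surface measure is uniform. -/
theorem lintegral_inv_sqrt {a s : ℝ} (ha : 0 < a) (hs : 0 < s) (has : s ≠ a) :
    ∫⁻ z in Ioo (-s) s, ENNReal.ofReal (√(s ^ 2 - 2 * a * z + a ^ 2))⁻¹ =
      ENNReal.ofReal (2 * s * min a⁻¹ s⁻¹) := by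
  have hpos : ∀ z ∈ uIcc (-s) s, 0 < s ^ 2 - 2 * a * z + a ^ 2 := by
    intro z hz
    rw [uIcc_of_le (by linarith)] at hz
    have : 0 < (s - a) ^ 2 := by have := sub_ne_zero.2 has; positivity
    nlinarith [mul_le_mul_of_nonneg_left hz.2 ha.le]
  have hcont : ContinuousOn (fun z => (√(s ^ 2 - 2 * a * z + a ^ 2))⁻¹) (uIcc (-s) s) :=
    ContinuousOn.inv₀ (by fun_prop) (fun z hz => (Real.sqrt_pos.2 (hpos z hz)).ne')
  have hderiv : ∀ z ∈ uIcc (-s) s, HasDerivAt (fun z => -√(s ^ 2 - 2 * a * z + a ^ 2) / a)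
      (√(s ^ 2 - 2 * a * z + a ^ 2))⁻¹ z := by
    intro z hz
    have h1 : HasDerivAt (fun z => s ^ 2 - 2 * a * z + a ^ 2) (-(2 * a)) z := by
      simpa using (((hasDerivAt_id z).const_mul (2 * a)).const_sub (s ^ 2)).add_const (a ^ 2)
    refine ((h1.sqrt (hpos z hz).ne').neg.div_const a).congr_deriv ?_
    have := Real.sqrt_pos.2 (hpos z hz)
    field_simp
  have hint := hcont.intervalIntegrable (μ := volume)
  have hval := intervalIntegral.integral_eq_sub_of_hasDerivAt hderiv hint
  rw [setLIntegral_congr Ioo_ae_eq_Ioc, ← ofReal_integral_eq_lintegral_ofReal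
    ((intervalIntegrable_iff_integrableOn_Ioc_of_le (by linarith)).1 hint)
    (Eventually.of_forall fun z => by positivity),
    ← intervalIntegral.integral_of_le (by linarith), hval]
  have h1 : √(s ^ 2 - 2 * a * s + a ^ 2) = |s - a| := by rw [← Real.sqrt_sq_eq_abs]; ring_nf
  have h2 : √(s ^ 2 - 2 * a * -s + a ^ 2) = s + a := by
    rw [← Real.sqrt_sq (by positivity : 0 ≤ s + a)]; ring_nf
  rw [h1, h2]
  congr 1
  rcases le_total s a with h | h
  · rw [abs_of_nonpos (by linarith), min_eq_left (inv_anti₀ hs h)]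
    field_simp; ring
  · rw [abs_of_nonneg (by linarith), min_eq_right (inv_anti₀ ha h)]
    field_simp; ring

theorem exists_linearIsometryEquiv_apply_eq (x : Space) :
    ∃ e : Space ≃ₗᵢ[ℝ] Space, e x = !₂[‖x‖, 0, 0] :=
  ⟨_, Submodule.reflection_sub (v := x) (w := !₂[‖x‖, 0, 0]) (by rw [norm_vec3]; simp)⟩

/-- Newton's theorem: a spherical shell acts at a point outside it as if its charge sat at the
centre, and has constant potential inside. In cylindrical coordinates around the axis through `x`
the shell of radius `s` contributes an elementary integral over the height `z ∈ (-s, s)`. -/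
theorem lintegral_radial_mul_inv_norm_sub {q : ℝ → ℝ≥0∞} (hq : Measurable q) {x : Space}
    (hx : x ≠ 0) :
    ∫⁻ y, q ‖y‖ * ENNReal.ofReal ‖x - y‖⁻¹ =
      ∫⁻ s in Ioi 0, ENNReal.ofReal (4 * Real.pi * s ^ 2 * min ‖x‖⁻¹ s⁻¹) * q s := by
  obtain ⟨e, he⟩ := exists_linearIsometryEquiv_apply_eq x
  set a := ‖x‖ with ha_def
  have ha : 0 < a := norm_pos_iff.2 hx
  have h1 : ∫⁻ y, q ‖y‖ * ENNReal.ofReal ‖x - y‖⁻¹ =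
      ∫⁻ y : Space, q ‖y‖ * ENNReal.ofReal ‖(!₂[a, 0, 0] : Space) - y‖⁻¹ := by
    rw [← e.measurePreserving.lintegral_comp
      (f := fun y => q ‖y‖ * ENNReal.ofReal ‖(!₂[a, 0, 0] : Space) - y‖⁻¹) (by fun_prop)]
    refine lintegral_congr fun y => ?_
    rw [e.norm_map, ← he, ← map_sub, e.norm_map]
  rw [h1, lintegral_space_eq _ (by fun_prop)]
  have h2 : ∀ z : ℝ, ∫⁻ p : ℝ × ℝ, q ‖(!₂[z, p.1, p.2] : Space)‖ *
      ENNReal.ofReal ‖(!₂[a, 0, 0] : Space) - !₂[z, p.1, p.2]‖⁻¹ =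
      ENNReal.ofReal (2 * Real.pi) * ∫⁻ s in Ioi |z|, ENNReal.ofReal s *
        (q s * ENNReal.ofReal (√(s ^ 2 - 2 * a * z + a ^ 2))⁻¹) := by
    intro z
    rw [← lintegral_plane_radial z
      (H := fun s => q s * ENNReal.ofReal (√(s ^ 2 - 2 * a * z + a ^ 2))⁻¹) (by fun_prop)]
    refine lintegral_congr fun p => ?_
    have h3 : (!₂[a, 0, 0] : Space) - !₂[z, p.1, p.2] = !₂[a - z, -p.1, -p.2] := by
      ext i; fin_cases i <;> simp
    rw [h3, norm_vec3, norm_vec3, Real.sq_sqrt (by positivity)]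
    congr 4
    ring_nf
  have hm : Measurable fun p : ℝ × ℝ => (Ioi |p.1|).indicator (fun s => ENNReal.ofReal s *
      (q s * ENNReal.ofReal (√(s ^ 2 - 2 * a * p.1 + a ^ 2))⁻¹)) p.2 := by
    have hS : MeasurableSet {p : ℝ × ℝ | |p.1| < p.2} :=
      measurableSet_lt (by fun_prop) measurable_snd
    have : Measurable ({p : ℝ × ℝ | |p.1| < p.2}.indicator fun p => ENNReal.ofReal p.2 *
      (q p.2 * ENNReal.ofReal (√(p.2 ^ 2 - 2 * a * p.1 + a ^ 2))⁻¹)) :=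
      Measurable.indicator (by fun_prop) hS
    convert! this using 1
  simp_rw [h2, ← lintegral_indicator measurableSet_Ioi]
  rw [lintegral_const_mul _ hm.lintegral_prod_right', lintegral_lintegral_swap hm.aemeasurable,
    ← lintegral_const_mul _ hm.lintegral_prod_left']
  refine lintegral_congr_ae ?_
  filter_upwards [Measure.ae_ne volume a] with s hs
  rcases le_or_gt s 0 with h0 | h0
  · have h3 : ∀ z : ℝ, s ∉ Ioi |z| := fun z hz => (abs_nonneg z).not_gt (lt_of_lt_of_le hz h0)
    rw [indicator_of_notMem (notMem_Ioi.2 h0)]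
    simp [indicator_of_notMem (h3 _)]
  · rw [indicator_of_mem (mem_Ioi.2 h0)]
    have h3 : ∀ z : ℝ, (Ioi |z|).indicator (fun s => ENNReal.ofReal s *
        (q s * ENNReal.ofReal (√(s ^ 2 - 2 * a * z + a ^ 2))⁻¹)) s =
        ENNReal.ofReal s * q s * (Ioo (-s) s).indicator
          (fun z => ENNReal.ofReal (√(s ^ 2 - 2 * a * z + a ^ 2))⁻¹) z := by
      intro z
      by_cases hz : |z| < s
      · rw [indicator_of_mem (mem_Ioi.2 hz), indicator_of_mem (mem_Ioo.2 (abs_lt.1 hz)),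
          ← mul_assoc]
      · rw [indicator_of_notMem (notMem_Ioi.2 (not_lt.1 hz)),
          indicator_of_notMem (fun h => hz (abs_lt.2 (mem_Ioo.1 h))), mul_zero]
    simp_rw [h3]
    rw [lintegral_const_mul _ (Measurable.indicator (by fun_prop) measurableSet_Ioo),
      lintegral_indicator measurableSet_Ioo, lintegral_inv_sqrt ha h0 hs]
    have h4 : 4 * Real.pi * s ^ 2 * min a⁻¹ s⁻¹ = 2 * Real.pi * (s * (2 * s * min a⁻¹ s⁻¹)) := by
      ring
    have h5 : 0 ≤ min a⁻¹ s⁻¹ := by positivity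
    rw [h4, ENNReal.ofReal_mul (p := 2 * Real.pi) (by positivity), ENNReal.ofReal_mul (p := s) h0.le]
    ring

/-! ### Positivity of the Coulomb energy -/

/-- A kernel of the form `K x y = ∫ k b x * k b y dν(b)` is positive semidefinite, on every function
for which the double integral converges absolutely. -/
theorem integral_mul_mul_kernel_nonneg {α β : Type*} [MeasurableSpace α] [MeasurableSpace β]
    {μ : Measure α} {ν : Measure β} [SFinite μ] [SFinite ν] {k : β → α → ℝ}
    (hk : Measurable (Function.uncurry k)) (hk0 : ∀ b x, 0 ≤ k b x) {K : α × α → ℝ}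
    (hK : ∀ᵐ p ∂μ.prod μ, Integrable (fun b => k b p.1 * k b p.2) ν ∧
      ∫ b, k b p.1 * k b p.2 ∂ν = K p)
    {f : α → ℝ} (hf : AEStronglyMeasurable f μ)
    (hint : Integrable (fun p => f p.1 * f p.2 * K p) (μ.prod μ)) :
    0 ≤ ∫ p, f p.1 * f p.2 * K p ∂μ.prod μ := by
  have hkm : Measurable fun q : (α × α) × β => k q.2 q.1.1 * k q.2 q.1.2 :=
    (hk.comp (measurable_snd.prodMk (measurable_fst.comp measurable_fst))).mul
      (hk.comp (measurable_snd.prodMk (measurable_snd.comp measurable_fst)))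
  have hF : Integrable (fun q : (α × α) × β => f q.1.1 * f q.1.2 * (k q.2 q.1.1 * k q.2 q.1.2))
      ((μ.prod μ).prod ν) := by
    refine (integrable_prod_iff ?_).2 ⟨?_, ?_⟩
    · exact ((hf.comp_fst.mul hf.comp_snd).comp_fst).mul hkm.aestronglyMeasurable
    · filter_upwards [hK] with p hp using hp.1.const_mul _
    · refine hint.norm.congr ?_
      filter_upwards [hK] with p hp
      have h1 : ∀ b, ‖f p.1 * f p.2 * (k b p.1 * k b p.2)‖ =
          ‖f p.1 * f p.2‖ * (k b p.1 * k b p.2) := fun b => by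
        rw [norm_mul, Real.norm_of_nonneg (mul_nonneg (hk0 _ _) (hk0 _ _))]
      simp_rw [h1]
      rw [integral_const_mul, hp.2, norm_mul, Real.norm_of_nonneg (r := K p)]
      rw [← hp.2]
      exact integral_nonneg fun b => mul_nonneg (hk0 _ _) (hk0 _ _)
  have h1 : ∫ p, f p.1 * f p.2 * K p ∂μ.prod μ =
      ∫ p, ∫ b, f p.1 * f p.2 * (k b p.1 * k b p.2) ∂ν ∂μ.prod μ := by
    refine integral_congr_ae ?_
    filter_upwards [hK] with p hp
    rw [integral_const_mul, hp.2]
  rw [h1, integral_integral_swap hF]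
  refine integral_nonneg fun b => ?_
  have h2 : ∀ p : α × α, f p.1 * f p.2 * (k b p.1 * k b p.2) =
      (f p.1 * k b p.1) * (f p.2 * k b p.2) := fun p => by ring
  simp_rw [h2]
  rw [integral_prod_mul (fun x => f x * k b x) (fun x => f x * k b x)]
  exact mul_self_nonneg _

/-- A Gaussian square root of the Coulomb kernel, in the parameters `b = (s, z)` of inverse width
`s > 0` and centre `z`. The weight `√(s ^ 3)` makes the integral over `z` of a product a pure
Gaussian in `s`. -/
noncomputable def gaussianKernel (b : ℝ × Space) (x : Space) : ℝ :=
  √(b.1 ^ 3) * Real.exp (-(2 * b.1 ^ 2 * ‖x - b.2‖ ^ 2))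

theorem integral_gaussianKernel_mul_space {s : ℝ} (hs : 0 < s) (x y : Space) :
    Integrable (fun z => gaussianKernel (s, z) x * gaussianKernel (s, z) y) ∧
    ∫ z, gaussianKernel (s, z) x * gaussianKernel (s, z) y =
      (Real.pi / 4) ^ (3 / 2 : ℝ) * Real.exp (-(‖x - y‖ ^ 2) * s ^ 2) := by
  have h1 : ∀ z, gaussianKernel (s, z) x * gaussianKernel (s, z) y =
      s ^ 3 * Real.exp (-(‖x - y‖ ^ 2) * s ^ 2) *
        Real.exp (-(4 * s ^ 2) * ‖z - (1 / 2 : ℝ) • (x + y)‖ ^ 2) := by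
    intro z
    -- Completing the square: the product is a Gaussian in `z` centred at the midpoint.
    have h2 := parallelogram_law_with_norm ℝ (x - z) (y - z)
    have h3 : x - z + (y - z) = (-2 : ℝ) • (z - (1 / 2 : ℝ) • (x + y)) := by module
    have h4 : x - z - (y - z) = x - y := by abel
    rw [h3, h4, norm_smul, show ‖(-2 : ℝ)‖ = 2 by norm_num] at h2
    have h5 : 0 ≤ s ^ 3 := by positivity
    unfold gaussianKernel
    simp only
    rw [mul_mul_mul_comm, Real.mul_self_sqrt h5, mul_assoc (s ^ 3), ← Real.exp_add, ← Real.exp_add]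
    congr 2
    linear_combination s ^ 2 * h2
  have h2 : ∫ z : Space, Real.exp (-(4 * s ^ 2) * ‖z - (1 / 2 : ℝ) • (x + y)‖ ^ 2) =
      (Real.pi / 4) ^ (3 / 2 : ℝ) / s ^ 3 := by
    rw [integral_sub_right_eq_self (fun z : Space => Real.exp (-(4 * s ^ 2) * ‖z‖ ^ 2)),
      GaussianFourier.integral_rexp_neg_mul_sq_norm (by positivity)]
    rw [← div_div, Real.div_rpow (by positivity) (by positivity)]
    congr 1
    · simp
    · rw [← Real.rpow_natCast_mul hs.le, ← Real.rpow_natCast]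
      norm_num
  -- The integral is nonzero, so the integrand is integrable.
  have h3 : Integrable fun z : Space =>
      Real.exp (-(4 * s ^ 2) * ‖z - (1 / 2 : ℝ) • (x + y)‖ ^ 2) := by
    by_contra h
    rw [integral_undef h] at h2
    have : 0 < (Real.pi / 4) ^ (3 / 2 : ℝ) / s ^ 3 := by positivity
    exact this.ne h2
  simp_rw [h1]
  refine ⟨h3.const_mul _, ?_⟩
  rw [integral_const_mul, h2]
  field_simp

theorem integral_gaussianKernel_mul {x y : Space} (hxy : x ≠ y) :
    Integrable (fun b => gaussianKernel b x * gaussianKernel b y)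
      ((volume.restrict (Ioi (0 : ℝ))).prod volume) ∧
    ∫ b, gaussianKernel b x * gaussianKernel b y ∂((volume.restrict (Ioi (0 : ℝ))).prod volume) =
      ((Real.pi / 4) ^ (3 / 2 : ℝ) * (√Real.pi / 2)) * ‖x - y‖⁻¹ := by
  have hr : 0 < ‖x - y‖ := norm_pos_iff.2 (sub_ne_zero.2 hxy)
  have hnn : ∀ b x, 0 ≤ gaussianKernel b x := fun b x => by unfold gaussianKernel; positivity
  have hint : Integrable (fun b => gaussianKernel b x * gaussianKernel b y)
      ((volume.restrict (Ioi (0 : ℝ))).prod volume) := by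
    refine (integrable_prod_iff ?_).2 ⟨?_, ?_⟩
    · unfold gaussianKernel
      exact Continuous.aestronglyMeasurable (by fun_prop)
    · filter_upwards [ae_restrict_mem measurableSet_Ioi] with s hs
      exact (integral_gaussianKernel_mul_space hs x y).1
    · refine (((integrable_exp_neg_mul_sq (b := ‖x - y‖ ^ 2) (by positivity)).restrict
        (s := Ioi 0)).const_mul ((Real.pi / 4) ^ (3 / 2 : ℝ))).congr ?_
      filter_upwards [ae_restrict_mem measurableSet_Ioi] with s hs
      rw [← (integral_gaussianKernel_mul_space hs x y).2]
      exact integral_congr_ae (Eventually.of_forall fun z =>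
        (Real.norm_of_nonneg (mul_nonneg (hnn _ _) (hnn _ _))).symm)
  refine ⟨hint, ?_⟩
  rw [integral_prod _ hint, setIntegral_congr_fun measurableSet_Ioi
    (fun s hs => (integral_gaussianKernel_mul_space hs x y).2), integral_const_mul, integral_gaussian_Ioi,
    Real.sqrt_div' _ (by positivity), Real.sqrt_sq hr.le]
  ring

/-- The Coulomb energy is positive semidefinite. -/
theorem integral_mul_mul_inv_norm_sub_nonneg {f : Space → ℝ} (hf : AEStronglyMeasurable f)
    (hint : Integrable (fun p : Space × Space => f p.1 * f p.2 / ‖p.1 - p.2‖)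
      (volume.prod volume)) :
    0 ≤ ∫ p : Space × Space, f p.1 * f p.2 / ‖p.1 - p.2‖ ∂(volume.prod volume) := by
  set C : ℝ := (Real.pi / 4) ^ (3 / 2 : ℝ) * (√Real.pi / 2) with hC
  have hC0 : 0 < C := by positivity
  have hK : ∀ᵐ p : Space × Space ∂(volume.prod volume),
      Integrable (fun b => gaussianKernel b p.1 * gaussianKernel b p.2)
        ((volume.restrict (Ioi (0 : ℝ))).prod volume) ∧
      ∫ b, gaussianKernel b p.1 * gaussianKernel b p.2
        ∂((volume.restrict (Ioi (0 : ℝ))).prod volume) = C * ‖p.1 - p.2‖⁻¹ := by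
    have : ∀ᵐ p : Space × Space ∂(volume.prod volume), p.1 ≠ p.2 := by
      rw [Measure.ae_prod_iff_ae_ae]
      · exact Eventually.of_forall fun x => by
          simpa [eq_comm] using Measure.ae_ne volume x
      · exact (measurableSet_eq_fun measurable_fst measurable_snd).compl
    filter_upwards [this] with p hp using integral_gaussianKernel_mul hp
  have heq : ∀ p : Space × Space, f p.1 * f p.2 * (C * ‖p.1 - p.2‖⁻¹) =
      C * (f p.1 * f p.2 / ‖p.1 - p.2‖) := fun p => by rw [div_eq_mul_inv]; ring
  have h1 := integral_mul_mul_kernel_nonneg (μ := volume)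
    (ν := (volume.restrict (Ioi (0 : ℝ))).prod volume)
    (k := gaussianKernel) (K := fun p => C * ‖p.1 - p.2‖⁻¹)
    (by unfold gaussianKernel; exact Continuous.measurable (by fun_prop))
    (fun b x => by unfold gaussianKernel; positivity) hK hf
    (by simp_rw [heq]; exact hint.const_mul C)
  simp_rw [heq] at h1
  rw [integral_const_mul] at h1
  exact nonneg_of_mul_nonneg_right h1 hC0

/-! ### The radial solution of the Thomas-Fermi equation -/

/-- The radial density `(φ / γ) ^ (3/2)` with potential `φ = y r / r`. -/
noncomputable def radialDensity (γ : ℝ) (y : ℝ → ℝ) (r : ℝ) : ℝ :=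
  (γ⁻¹ * (y r * r⁻¹)) ^ (3 / 2 : ℝ)

/-- The right-hand side of the Thomas-Fermi equation `y'' = c x ^ (-1/2) y ^ (3/2)`. -/
noncomputable def profileSource (c : ℝ) (y : ℝ → ℝ) (s : ℝ) : ℝ := c * y s ^ (3 / 2 : ℝ) / √s

/-- The constant `c = 4 π γ ^ (-3/2)` in the radial Thomas-Fermi equation. -/
noncomputable def radialConst (γ : ℝ) : ℝ := 4 * Real.pi * γ⁻¹ ^ (3 / 2 : ℝ)

theorem radialConst_pos {γ : ℝ} (hγ : 0 < γ) : 0 < radialConst γ := by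
  unfold radialConst; positivity

/-- The radial Poisson equation: the charge `4 π s² ρ(s)` of a shell is `s y''(s)`. -/
theorem four_pi_sq_mul_radialDensity {γ : ℝ} (hγ : 0 < γ) {y : ℝ → ℝ} (hy : ∀ r, 0 ≤ y r) {s : ℝ}
    (hs : 0 < s) :
    4 * Real.pi * s ^ 2 * radialDensity γ y s = s * profileSource (radialConst γ) y s := by
  have h0 := hy s
  have h1 : 0 < √s := Real.sqrt_pos.2 hs
  have h2 : (s⁻¹) ^ (3 / 2 : ℝ) = (s * √s)⁻¹ := by
    rw [Real.inv_rpow hs.le, show (3 / 2 : ℝ) = 1 + 1 / 2 by norm_num, Real.rpow_add hs,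
      Real.rpow_one, Real.sqrt_eq_rpow]
  unfold radialDensity profileSource radialConst
  rw [Real.mul_rpow (by positivity) (by positivity), Real.mul_rpow h0 (by positivity), h2]
  field_simp

theorem convexOn_mul_inv {y : ℝ → ℝ} (hconv : ConvexOn ℝ (Ioi 0) y) (hy : ∀ r, 0 ≤ y r)
    (hanti : Antitone y) : ConvexOn ℝ (Ioi 0) fun r => y r * r⁻¹ := by
  have h1 : ConvexOn ℝ (Ioi (0 : ℝ)) fun r : ℝ => r⁻¹ := by
    simpa using convexOn_zpow (𝕜 := ℝ) (-1)
  -- Two nonnegative convex functions that vary in the same direction have a convex product.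
  refine hconv.mul h1 (fun r _ => hy r) (fun r hr => (inv_pos.2 hr).le) ?_
  intro a ha b hb hab
  exact hanti ((inv_lt_inv₀ ha hb).1 hab).le

theorem convexOn_rpow_comp {s : Set ℝ} {h : ℝ → ℝ} (hh : ConvexOn ℝ s h) (h0 : ∀ x ∈ s, 0 ≤ h x)
    {p : ℝ} (hp : 1 ≤ p) : ConvexOn ℝ s fun x => h x ^ p := by
  refine ⟨hh.1, fun a ha b hb α β hα hβ hαβ => ?_⟩
  refine (Real.rpow_le_rpow (h0 _ (hh.1 ha hb hα hβ hαβ)) (hh.2 ha hb hα hβ hαβ)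
    (by linarith)).trans ?_
  exact (convexOn_rpow hp).2 (h0 a ha) (h0 b hb) hα hβ hαβ

/-- The analytic content of the Thomas-Fermi equation `γ ρ ^ (2/3) = Z / |x| - ρ * |·|⁻¹` for a
nonnegative density of finite electron-nucleus attraction. -/
structure SolvesTF (γ Z : ℝ) (ρ : Space → ℝ) : Prop where
  measurable : Measurable ρ
  nonneg : ∀ x, 0 ≤ ρ x
  integrable_div_norm : Integrable fun x => ρ x / ‖x‖
  integrable_potential : ∀ x, x ≠ 0 → Integrable fun y => ρ y / ‖x - y‖
  equation : ∀ x, x ≠ 0 → ∫ y, ρ y / ‖x - y‖ = Z / ‖x‖ - γ * ρ x ^ (2 / 3 : ℝ)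

namespace IsTFProfile

variable {γ Z : ℝ} {y v : ℝ → ℝ}

theorem convexOn {c : ℝ} (h : IsTFProfile c Z y v) (hc : 0 ≤ c) : ConvexOn ℝ (Ioi 0) y := by
  have hd : ∀ x ∈ Ioi (0 : ℝ), deriv y x = v x := fun x hx => (h.hasDerivAt x hx).deriv
  refine MonotoneOn.convexOn_of_deriv (convex_Ioi 0) h.continuous.continuousOn ?_ ?_ <;>
    rw [interior_Ioi]
  · exact fun x hx => (h.hasDerivAt x hx).differentiableAt.differentiableWithinAt
  · intro a ha b hb hab
    rw [hd a ha, hd b hb]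
    exact h.monotoneOn_deriv hc (Ioi_subset_Ici_self ha) (Ioi_subset_Ici_self hb) hab

section

variable {c : ℝ} (h : IsTFProfile c Z y v) (hc : 0 ≤ c)
include h hc

theorem profileSource_nonneg (s : ℝ) : 0 ≤ profileSource c y s := by
  have := h.nonneg s
  unfold profileSource
  positivity

theorem integrableOn_profileSource {a : ℝ} (ha : 0 ≤ a) :
    IntegrableOn (profileSource c y) (Ioi a) :=
  integrableOn_Ioi_deriv_of_nonneg h.continuous_deriv.continuousWithinAt
    (fun x hx => h.hasDerivAt_deriv x (ha.trans_lt hx)) (fun x _ => h.profileSource_nonneg hc x)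
    (h.tendsto_deriv hc)

theorem integral_profileSource {a : ℝ} (ha : 0 ≤ a) :
    ∫ s in Ioi a, profileSource c y s = -v a := by
  rw [← zero_sub]
  exact integral_Ioi_of_hasDerivAt_of_nonneg h.continuous_deriv.continuousWithinAt
    (fun x hx => h.hasDerivAt_deriv x (ha.trans_lt hx)) (fun x _ => h.profileSource_nonneg hc x)
    (h.tendsto_deriv hc)

omit hc in
/-- `x y'' = (x y' - y)'`, which evaluates the total charge. -/
theorem hasDerivAt_mul_deriv_sub {x : ℝ} (hx : 0 < x) :
    HasDerivAt (fun x => x * v x - y x) (x * profileSource c y x) x :=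
  (((hasDerivAt_id x).mul (h.hasDerivAt_deriv x hx)).sub (h.hasDerivAt x hx)).congr_deriv
    (by simp [profileSource])

theorem tendsto_mul_deriv_sub : Tendsto (fun x => x * v x - y x) atTop (𝓝 0) := by
  simpa using (h.tendsto_mul_deriv hc).sub h.tendsto

omit hc in
theorem continuous_mul_deriv_sub : Continuous fun x => x * v x - y x :=
  (continuous_id.mul h.continuous_deriv).sub h.continuous

theorem integrableOn_mul_profileSource {a : ℝ} (ha : 0 ≤ a) :
    IntegrableOn (fun s => s * profileSource c y s) (Ioi a) :=
  integrableOn_Ioi_deriv_of_nonneg h.continuous_mul_deriv_sub.continuousWithinAt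
    (fun _ hx => h.hasDerivAt_mul_deriv_sub (ha.trans_lt hx))
    (fun x hx => mul_nonneg (ha.trans_lt hx).le (h.profileSource_nonneg hc x))
    (h.tendsto_mul_deriv_sub hc)

theorem integral_mul_profileSource {a : ℝ} (ha : 0 ≤ a) :
    ∫ s in Ioi a, s * profileSource c y s = y a - a * v a := by
  rw [← neg_sub, ← zero_sub]
  exact integral_Ioi_of_hasDerivAt_of_nonneg h.continuous_mul_deriv_sub.continuousWithinAt
    (fun _ hx => h.hasDerivAt_mul_deriv_sub (ha.trans_lt hx))
    (fun x hx => mul_nonneg (ha.trans_lt hx).le (h.profileSource_nonneg hc x))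
    (h.tendsto_mul_deriv_sub hc)

/-- The radial Green function `min (1/r) (1/s)` inverts the radial Laplacian. -/
theorem integral_mul_min_profileSource {r : ℝ} (hr : 0 < r) :
    IntegrableOn (fun s => s * profileSource c y s * min r⁻¹ s⁻¹) (Ioi 0) ∧
    ∫ s in Ioi 0, s * profileSource c y s * min r⁻¹ s⁻¹ = (Z - y r) / r := by
  have hI := h.integrableOn_mul_profileSource hc le_rfl
  have e1 : EqOn (fun s => s * profileSource c y s * min r⁻¹ s⁻¹)
      (fun s => s * profileSource c y s * r⁻¹) (Ioc 0 r) := fun s hs => by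
    simp only [min_eq_left (inv_anti₀ hs.1 hs.2)]
  have e2 : EqOn (fun s => s * profileSource c y s * min r⁻¹ s⁻¹)
      (profileSource c y) (Ioi r) := fun s hs => by
    have hs' : r < s := hs
    have hs0 : 0 < s := hr.trans hs'
    simp only [min_eq_right (inv_anti₀ hr hs'.le)]
    field_simp
  have i1 : IntegrableOn (fun s => s * profileSource c y s * min r⁻¹ s⁻¹) (Ioc 0 r) :=
    IntegrableOn.congr_fun ((hI.mono_set Ioc_subset_Ioi_self).mul_const r⁻¹) e1.symm
      measurableSet_Ioc
  have i2 : IntegrableOn (fun s => s * profileSource c y s * min r⁻¹ s⁻¹) (Ioi r) :=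
    IntegrableOn.congr_fun (h.integrableOn_profileSource hc hr.le) e2.symm measurableSet_Ioi
  have hun : Ioi (0 : ℝ) = Ioc 0 r ∪ Ioi r := (Ioc_union_Ioi_eq_Ioi hr.le).symm
  have hdisj : Disjoint (Ioc (0 : ℝ) r) (Ioi r) := Ioc_disjoint_Ioi_same
  have h1 : ∫ s in Ioc 0 r, s * profileSource c y s = Z - y r + r * v r := by
    have h2 := h.integral_mul_profileSource hc le_rfl
    rw [hun, setIntegral_union hdisj measurableSet_Ioi (hI.mono_set Ioc_subset_Ioi_self)
      (hI.mono_set (Ioi_subset_Ioi hr.le)), h.integral_mul_profileSource hc hr.le, h.zero] at h2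
    linarith
  refine ⟨hun ▸ i1.union i2, ?_⟩
  rw [hun, setIntegral_union hdisj measurableSet_Ioi i1 i2,
    setIntegral_congr_fun measurableSet_Ioc e1, setIntegral_congr_fun measurableSet_Ioi e2,
    integral_mul_const, h1, h.integral_profileSource hc hr.le]
  field_simp
  ring

end

variable (h : IsTFProfile (radialConst γ) Z y v) (hγ : 0 < γ)
include h hγ

theorem radialDensity_nonneg {r : ℝ} (hr : 0 ≤ r) : 0 ≤ radialDensity γ y r := by
  have := h.nonneg r
  unfold radialDensity
  positivity

theorem antitoneOn_radialDensity : AntitoneOn (radialDensity γ y) (Ioi 0) := by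
  intro a ha b hb hab
  have ha' : 0 < a := ha
  have hb' : 0 < b := hb
  have := h.nonneg b
  have := h.nonneg a
  unfold radialDensity
  gcongr
  exact h.antitone hab

theorem convexOn_radialDensity : ConvexOn ℝ (Ioi 0) (radialDensity γ y) := by
  refine convexOn_rpow_comp ?_ (fun r hr => ?_) (by norm_num)
  · exact (convexOn_mul_inv (h.convexOn (radialConst_pos hγ).le) h.nonneg h.antitone).smul
      (inv_pos.2 hγ).le
  · have hr' : 0 < r := hr
    have := h.nonneg r
    positivity

omit hγ in
theorem measurable_radialDensity : Measurable (radialDensity γ y) := by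
  have := h.continuous.measurable
  unfold radialDensity
  fun_prop

theorem rpow_radialDensity {r : ℝ} (hr : 0 ≤ r) :
    γ * radialDensity γ y r ^ (2 / 3 : ℝ) = y r / r := by
  have := h.nonneg r
  unfold radialDensity
  rw [← Real.rpow_mul (by positivity)]
  norm_num
  field_simp

theorem integrable_radialDensity : Integrable fun x : Space => radialDensity γ y ‖x‖ := by
  rw [integrable_fun_norm_addHaar]
  refine IntegrableOn.congr_fun ((h.integrableOn_mul_profileSource (radialConst_pos hγ).le
    le_rfl).const_mul (4 * Real.pi)⁻¹) (fun s hs => ?_) measurableSet_Ioi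
  simp only [finrank_euclideanSpace, Fintype.card_fin, smul_eq_mul, Nat.add_one_sub_one]
  rw [← four_pi_sq_mul_radialDensity hγ h.nonneg hs]
  field_simp

theorem integral_radialDensity : ∫ x : Space, radialDensity γ y ‖x‖ = Z := by
  have h1 : ∀ s ∈ Ioi (0 : ℝ), s ^ 2 * radialDensity γ y s =
      (4 * Real.pi)⁻¹ * (s * profileSource (radialConst γ) y s) := by
    intro s hs
    rw [← four_pi_sq_mul_radialDensity hγ h.nonneg hs]
    field_simp
  rw [integral_fun_norm_addHaar]
  simp only [finrank_euclideanSpace, Fintype.card_fin, smul_eq_mul, Nat.add_one_sub_one]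
  rw [setIntegral_congr_fun measurableSet_Ioi h1, integral_const_mul,
    h.integral_mul_profileSource (radialConst_pos hγ).le le_rfl, h.zero, measureReal_def,
    EuclideanSpace.volume_ball_fin_three]
  simp [ENNReal.toReal_ofReal (show 0 ≤ Real.pi * 4 / 3 by positivity)]
  field_simp

theorem lintegral_radialDensity_mul {x : Space} (hx : x ≠ 0) :
    ∫⁻ z, ENNReal.ofReal (radialDensity γ y ‖z‖ / ‖x - z‖) =
      ENNReal.ofReal ((Z - y ‖x‖) / ‖x‖) := by
  have hr : 0 < ‖x‖ := norm_pos_iff.2 hx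
  have hc := (radialConst_pos hγ).le
  have hm := h.measurable_radialDensity
  have h1 := lintegral_radial_mul_inv_norm_sub
    (q := fun r => ENNReal.ofReal (radialDensity γ y r)) (by fun_prop) hx
  have h2 : ∀ z : Space, ENNReal.ofReal (radialDensity γ y ‖z‖ / ‖x - z‖) =
      ENNReal.ofReal (radialDensity γ y ‖z‖) * ENNReal.ofReal ‖x - z‖⁻¹ := fun z => by
    rw [div_eq_mul_inv, ENNReal.ofReal_mul (h.radialDensity_nonneg hγ (norm_nonneg _))]
  simp_rw [h2]
  rw [h1, ← (h.integral_mul_min_profileSource hc hr).2, ofReal_integral_eq_lintegral_ofReal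
    (h.integral_mul_min_profileSource hc hr).1]
  · refine setLIntegral_congr_fun measurableSet_Ioi fun s hs => ?_
    have hs' : 0 < s := hs
    rw [← four_pi_sq_mul_radialDensity hγ h.nonneg hs, ← ENNReal.ofReal_mul (by positivity)]
    congr 1
    ring
  · filter_upwards [ae_restrict_mem measurableSet_Ioi] with s hs
    have hs' : 0 < s := hs
    have := h.profileSource_nonneg hc s
    change 0 ≤ _
    positivity

/-- The density built from the radial profile solves the Thomas-Fermi equation. -/
theorem solvesTF : SolvesTF γ Z fun x => radialDensity γ y ‖x‖ := by
  have hm := h.measurable_radialDensity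
  have hnn : ∀ x : Space, 0 ≤ radialDensity γ y ‖x‖ := fun x =>
    h.radialDensity_nonneg hγ (norm_nonneg x)
  have hpot : ∀ x : Space, x ≠ 0 → Integrable fun z => radialDensity γ y ‖z‖ / ‖x - z‖ := by
    intro x hx
    rw [← lintegral_ofReal_ne_top_iff_integrable
      (Measurable.aestronglyMeasurable (by fun_prop))
      (Eventually.of_forall fun z => div_nonneg (hnn z) (norm_nonneg _)),
      h.lintegral_radialDensity_mul hγ hx]
    exact ENNReal.ofReal_ne_top
  refine ⟨by fun_prop, hnn, ?_, hpot, fun x hx => ?_⟩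
  · refine (integrable_fun_norm_addHaar volume
      (f := fun r => radialDensity γ y r / r)).2 ?_
    refine IntegrableOn.congr_fun ((h.integrableOn_profileSource (radialConst_pos hγ).le
      le_rfl).const_mul (4 * Real.pi)⁻¹) (fun s hs => ?_) measurableSet_Ioi
    have hs' : 0 < s := hs
    simp only [finrank_euclideanSpace, Fintype.card_fin, smul_eq_mul, Nat.add_one_sub_one]
    have := four_pi_sq_mul_radialDensity hγ h.nonneg hs
    field_simp
    field_simp at this
    linarith
  · have hr : 0 < ‖x‖ := norm_pos_iff.2 hx
    rw [integral_eq_lintegral_of_nonneg_ae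
      (Eventually.of_forall fun z => div_nonneg (hnn z) (norm_nonneg _))
      (Measurable.aestronglyMeasurable (by fun_prop)), h.lintegral_radialDensity_mul hγ hx,
      ENNReal.toReal_ofReal (div_nonneg (sub_nonneg.2 (h.le (norm_nonneg _))) hr.le),
      h.rpow_radialDensity hγ (norm_nonneg _), sub_div]

end IsTFProfile

/-! ### The energy identity and the variational characterization -/

theorem toReal_five_thirds : ((5 / 3 : ℝ≥0∞)).toReal = 5 / 3 := by
  simp [ENNReal.toReal_div]

theorem integrable_rpow_of_mem_admissible {σ : Space → ℝ} (hσ : σ ∈ admissible) :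
    Integrable fun x => σ x ^ (5 / 3 : ℝ) := by
  have h1 := hσ.1.integrable_norm_rpow (by simp) (ENNReal.div_ne_top (by simp) (by simp))
  rw [toReal_five_thirds] at h1
  refine h1.congr ?_
  filter_upwards [hσ.2.1] with x hx
  rw [Real.norm_of_nonneg hx]

theorem integrableOn_ball_norm_rpow :
    IntegrableOn (fun x : Space => ‖x‖⁻¹ ^ (5 / 2 : ℝ)) (Metric.ball 0 1) := by
  rw [integrableOn_fun_norm_addHaar volume (f := fun r : ℝ => r⁻¹ ^ (5 / 2 : ℝ))]
  refine IntegrableOn.congr_fun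
    ((intervalIntegral.integrableOn_Ioo_rpow_iff (s := -(1 / 2)) one_pos).2 (by norm_num))
    (fun r hr => ?_) measurableSet_Ioo
  simp only [finrank_euclideanSpace, Fintype.card_fin, smul_eq_mul, Nat.add_one_sub_one]
  rw [Real.inv_rpow hr.1.le, ← Real.rpow_neg hr.1.le, ← Real.rpow_natCast, ← Real.rpow_add hr.1]
  norm_num

/-- An admissible density has finite attraction to the nucleus: near the origin by Hölder
duality of `L^{5/3}` and `|x|⁻¹ ∈ L^{5/2}`, far away because its Coulomb potential is finite at
some point. -/
theorem integrable_div_norm_of_mem_admissible {σ : Space → ℝ} (hσ : σ ∈ admissible) :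
    Integrable fun x => σ x / ‖x‖ := by
  have hm : AEStronglyMeasurable σ := hσ.1.aestronglyMeasurable
  have hm' : AEStronglyMeasurable fun x => σ x / ‖x‖ :=
    hm.mul (Measurable.aestronglyMeasurable (by fun_prop : Measurable fun x : Space => ‖x‖⁻¹))
  have hin : IntegrableOn (fun x => σ x / ‖x‖) (Metric.ball 0 1) := by
    refine ((integrable_rpow_of_mem_admissible hσ).integrableOn.add
      integrableOn_ball_norm_rpow).mono' hm'.restrict (ae_restrict_of_ae ?_)
    filter_upwards [hσ.2.1] with x hx
    have h1 := Real.young_inequality_of_nonneg hx (inv_nonneg.2 (norm_nonneg x))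
      (p := 5 / 3) (q := 5 / 2) (by constructor <;> norm_num)
    have h2 : 0 ≤ σ x ^ (5 / 3 : ℝ) := by positivity
    have h3 : 0 ≤ ‖x‖⁻¹ ^ (5 / 2 : ℝ) := by positivity
    rw [Real.norm_of_nonneg (by positivity), div_eq_mul_inv, Pi.add_apply]
    linarith
  have hout : IntegrableOn (fun x => σ x / ‖x‖) (Metric.ball 0 1)ᶜ := by
    by_cases h0 : σ =ᵐ[volume] 0
    · refine Integrable.integrableOn ((integrable_zero _ _ _).congr ?_)
      filter_upwards [h0] with x hx
      simp [hx]
    obtain ⟨y, hy, hy0⟩ : ∃ y, Integrable (fun x => σ x * σ y / ‖x - y‖) ∧ σ y ≠ 0 := by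
      by_contra! hcon
      refine h0 ?_
      filter_upwards [hσ.2.2.prod_left_ae] with y hy using hcon y hy
    have h1 : Integrable fun x => σ x / ‖x - y‖ := by
      refine (hy.mul_const (σ y)⁻¹).congr (Eventually.of_forall fun x => ?_)
      simp only
      field_simp
    refine ((h1.norm.const_mul (1 + ‖y‖)).integrableOn).mono' hm'.restrict ?_
    filter_upwards [ae_restrict_mem Metric.isOpen_ball.measurableSet.compl,
      ae_restrict_of_ae (Measure.ae_ne volume y)] with x hx hxy
    have hx1 : 1 ≤ ‖x‖ := by simpa using hx
    have h2 : 0 < ‖x - y‖ := norm_pos_iff.2 (sub_ne_zero.2 hxy)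
    have h3 : ‖x - y‖ ≤ (1 + ‖y‖) * ‖x‖ := by
      have := norm_sub_le x y
      nlinarith [norm_nonneg y]
    rw [norm_div, norm_div, norm_norm, norm_norm, mul_div_assoc', div_le_div_iff₀ (by linarith) h2]
    nlinarith [norm_nonneg (σ x)]
  rw [← integrableOn_univ, ← union_compl_self (Metric.ball (0 : Space) 1)]
  exact hin.union hout

/-- The Bregman divergence of `(3/5) t ^ (5/3)`. -/
noncomputable def bregman (s r : ℝ) : ℝ :=
  3 / 5 * (s ^ (5 / 3 : ℝ) - r ^ (5 / 3 : ℝ)) - r ^ (2 / 3 : ℝ) * (s - r)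

/-- In terms of cube roots the divergence is a polynomial divisible by `(a - b) ^ 2`. -/
theorem bregman_nonneg_and_eq {s r : ℝ} (hs : 0 ≤ s) (hr : 0 ≤ r) :
    0 ≤ bregman s r ∧ (bregman s r = 0 → s = r) := by
  obtain ⟨a, ha, rfl⟩ : ∃ a : ℝ, 0 ≤ a ∧ a ^ 3 = s :=
    ⟨s ^ (1 / 3 : ℝ), by positivity, by rw [← Real.rpow_mul_natCast hs]; norm_num⟩
  obtain ⟨b, hb, rfl⟩ : ∃ b : ℝ, 0 ≤ b ∧ b ^ 3 = r :=
    ⟨r ^ (1 / 3 : ℝ), by positivity, by rw [← Real.rpow_mul_natCast hr]; norm_num⟩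
  have h5 : ∀ u : ℝ, 0 ≤ u → (u ^ 3) ^ (5 / 3 : ℝ) = u ^ 5 := fun u hu => by
    rw [← Real.rpow_natCast_mul hu, ← Real.rpow_natCast]; norm_num
  have h2 : (b ^ 3) ^ (2 / 3 : ℝ) = b ^ 2 := by
    rw [← Real.rpow_natCast_mul hb, ← Real.rpow_natCast]; norm_num
  have key : bregman (a ^ 3) (b ^ 3) =
      1 / 5 * (a - b) ^ 2 * (3 * a ^ 3 + 6 * a ^ 2 * b + 4 * a * b ^ 2 + 2 * b ^ 3) := by
    unfold bregman
    rw [h5 a ha, h5 b hb, h2]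
    ring
  rw [key]
  refine ⟨by positivity, fun h => ?_⟩
  rcases mul_eq_zero.1 h with h | h
  · have : a - b = 0 := by simpa using h
    rw [sub_eq_zero.1 this]
  · have ha3 : 0 ≤ a ^ 3 := by positivity
    have hb3 : 0 ≤ b ^ 3 := by positivity
    have : 0 ≤ 6 * a ^ 2 * b + 4 * a * b ^ 2 := by positivity
    linarith

theorem integrable_tfFunctional_integrand {σ : Space → ℝ} (hσ : σ ∈ admissible) (γ Z : ℝ) :
    Integrable fun x => 3 / 5 * γ * σ x ^ (5 / 3 : ℝ) - Z / ‖x‖ * σ x :=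
  ((integrable_rpow_of_mem_admissible hσ).const_mul _).sub
    (((integrable_div_norm_of_mem_admissible hσ).const_mul Z).congr
      (Eventually.of_forall fun x => by simp only; ring))

theorem coulombEnergy_eq {σ : Space → ℝ} (hσ : Integrable
    (fun p : Space × Space => σ p.1 * σ p.2 / ‖p.1 - p.2‖) (volume.prod volume)) :
    coulombEnergy σ =
      1 / 2 * ∫ p : Space × Space, σ p.1 * σ p.2 / ‖p.1 - p.2‖ ∂(volume.prod volume) := by
  rw [coulombEnergy, integral_prod _ hσ]

namespace SolvesTF

variable {γ Z : ℝ} {ρ : Space → ℝ} (h : SolvesTF γ Z ρ)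
include h

theorem potential_nonneg (x : Space) : 0 ≤ ∫ y, ρ y / ‖x - y‖ :=
  integral_nonneg fun y => div_nonneg (h.nonneg y) (norm_nonneg _)

theorem rpow_le (x : Space) (hx : x ≠ 0) : γ * ρ x ^ (2 / 3 : ℝ) ≤ Z / ‖x‖ := by
  have h1 := h.potential_nonneg x
  rw [h.equation x hx] at h1
  linarith

variable (hγ : 0 < γ)
include hγ

theorem potential_le (x : Space) (hx : x ≠ 0) : ∫ y, ρ y / ‖x - y‖ ≤ Z / ‖x‖ := by
  rw [h.equation x hx]
  have := h.nonneg x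
  have : 0 ≤ γ * ρ x ^ (2 / 3 : ℝ) := by positivity
  linarith

/-- The interaction of the solution with a density of finite nuclear attraction converges,
because its potential is dominated by that of the nucleus. -/
theorem integrable_interaction {σ : Space → ℝ} (hm : AEStronglyMeasurable σ)
    (hσ : Integrable fun x => σ x / ‖x‖) :
    Integrable (fun p : Space × Space => σ p.1 * ρ p.2 / ‖p.1 - p.2‖) (volume.prod volume) := by
  have hmeas : AEStronglyMeasurable (fun p : Space × Space => σ p.1 * ρ p.2 / ‖p.1 - p.2‖)
      (volume.prod volume) := by
    have := h.measurable
    exact (hm.comp_fst.mul (Measurable.aestronglyMeasurable (by fun_prop))).mul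
      (Measurable.aestronglyMeasurable
        (by fun_prop : Measurable fun p : Space × Space => ‖p.1 - p.2‖⁻¹))
  refine (integrable_prod_iff hmeas).2 ⟨?_, ?_⟩
  · filter_upwards [Measure.ae_ne volume 0] with x hx
    simpa only [mul_div_assoc] using (h.integrable_potential x hx).const_mul (σ x)
  · refine (hσ.norm.const_mul Z).mono' hmeas.norm.integral_prod_right' ?_
    filter_upwards [Measure.ae_ne volume 0] with x hx
    have h1 : ∀ y, ‖σ x * ρ y / ‖x - y‖‖ = ‖σ x‖ * (ρ y / ‖x - y‖) := fun y => by
      rw [norm_div, norm_mul, norm_norm, Real.norm_of_nonneg (h.nonneg y), mul_div_assoc]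
    simp_rw [h1]
    rw [integral_const_mul, norm_mul, norm_norm, Real.norm_of_nonneg (h.potential_nonneg x),
      norm_div, norm_norm]
    calc ‖σ x‖ * ∫ y, ρ y / ‖x - y‖ ≤ ‖σ x‖ * (Z / ‖x‖) := by
          gcongr; exact h.potential_le hγ x hx
      _ = Z * (‖σ x‖ / ‖x‖) := by ring

theorem integrable_mul_potential {σ : Space → ℝ} (hm : AEStronglyMeasurable σ)
    (hσ : Integrable fun x => σ x / ‖x‖) :
    Integrable (fun x => σ x * ∫ y, ρ y / ‖x - y‖) ∧
    ∫ p : Space × Space, σ p.1 * ρ p.2 / ‖p.1 - p.2‖ ∂(volume.prod volume) =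
      ∫ x, σ x * ∫ y, ρ y / ‖x - y‖ := by
  have h1 := h.integrable_interaction hγ hm hσ
  have h2 : ∀ x, ∫ y, σ x * ρ y / ‖x - y‖ = σ x * ∫ y, ρ y / ‖x - y‖ := fun x => by
    rw [← integral_const_mul]; simp_rw [mul_div_assoc]
  refine ⟨?_, ?_⟩
  · simpa only [h2] using h1.integral_prod_left
  · rw [integral_prod _ h1]; simp_rw [h2]

/-- The bound `γ ρ ^ (2/3) ≤ Z / |x|` gives `ρ ^ (5/3) ≤ (Z / γ) ρ / |x|`. -/
theorem mem_admissible : ρ ∈ admissible := by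
  have hm := h.measurable.aestronglyMeasurable (μ := (volume : Measure Space))
  refine ⟨?_, Eventually.of_forall h.nonneg, h.integrable_interaction hγ hm h.integrable_div_norm⟩
  rw [← integrable_norm_rpow_iff hm (by simp) (ENNReal.div_ne_top (by simp) (by simp)),
    toReal_five_thirds]
  have := h.measurable
  refine (h.integrable_div_norm.const_mul (Z / γ)).mono'
    (Measurable.aestronglyMeasurable (by fun_prop)) ?_
  filter_upwards [Measure.ae_ne volume 0] with x hx
  have h0 := h.nonneg x
  have h1 := h.rpow_le x hx
  rw [Real.norm_of_nonneg h0, Real.norm_of_nonneg (by positivity),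
    show (5 / 3 : ℝ) = 2 / 3 + 1 by norm_num, Real.rpow_add_of_nonneg h0 (by norm_num) (by norm_num),
    Real.rpow_one]
  calc ρ x ^ (2 / 3 : ℝ) * ρ x = γ⁻¹ * (γ * ρ x ^ (2 / 3 : ℝ)) * ρ x := by field_simp
    _ ≤ γ⁻¹ * (Z / ‖x‖) * ρ x := by gcongr
    _ = Z / γ * (ρ x / ‖x‖) := by ring

/-- The excess energy over a solution of the Thomas-Fermi equation is the sum of a Bregman
divergence and of a Coulomb energy. -/
theorem tfFunctional_sub {σ : Space → ℝ} (hσ : σ ∈ admissible) :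
    Integrable (fun x => bregman (σ x) (ρ x)) ∧
    Integrable (fun p : Space × Space => (σ p.1 - ρ p.1) * (σ p.2 - ρ p.2) / ‖p.1 - p.2‖)
      (volume.prod volume) ∧
    tfFunctional γ Z σ - tfFunctional γ Z ρ = γ * (∫ x, bregman (σ x) (ρ x)) +
      1 / 2 * ∫ p : Space × Space, (σ p.1 - ρ p.1) * (σ p.2 - ρ p.2) / ‖p.1 - p.2‖
        ∂(volume.prod volume) := by
  have hρ := h.mem_admissible hγ
  have hσm := hσ.1.aestronglyMeasurable
  have hρm := hρ.1.aestronglyMeasurable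
  have hσn := integrable_div_norm_of_mem_admissible hσ
  obtain ⟨iσV, eσV⟩ := h.integrable_mul_potential hγ hσm hσn
  obtain ⟨iρV, eρV⟩ := h.integrable_mul_potential hγ hρm h.integrable_div_norm
  have iσρ := h.integrable_interaction hγ hσm hσn
  have iρσ : Integrable (fun p : Space × Space => ρ p.1 * σ p.2 / ‖p.1 - p.2‖)
      (volume.prod volume) := by
    refine iσρ.swap.congr (Eventually.of_forall fun p => ?_)
    simp only [Function.comp_apply, Prod.fst_swap, Prod.snd_swap]
    rw [norm_sub_rev, mul_comm]
  have eρσ : ∫ p : Space × Space, ρ p.1 * σ p.2 / ‖p.1 - p.2‖ ∂(volume.prod volume) =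
      ∫ p : Space × Space, σ p.1 * ρ p.2 / ‖p.1 - p.2‖ ∂(volume.prod volume) := by
    rw [← integral_prod_swap]
    refine integral_congr_ae (Eventually.of_forall fun p => ?_)
    simp only [Prod.fst_swap, Prod.snd_swap]
    rw [norm_sub_rev, mul_comm]
  have hQ : ∀ p : Space × Space, (σ p.1 - ρ p.1) * (σ p.2 - ρ p.2) / ‖p.1 - p.2‖ =
      (σ p.1 * σ p.2 / ‖p.1 - p.2‖ - σ p.1 * ρ p.2 / ‖p.1 - p.2‖) -
      (ρ p.1 * σ p.2 / ‖p.1 - p.2‖ - ρ p.1 * ρ p.2 / ‖p.1 - p.2‖) := fun p => by ring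
  have iσ := integrable_tfFunctional_integrand hσ γ Z
  have iρ := integrable_tfFunctional_integrand hρ γ Z
  have hB : (fun x => γ * bregman (σ x) (ρ x)) =ᵐ[volume] fun x =>
      ((3 / 5 * γ * σ x ^ (5 / 3 : ℝ) - Z / ‖x‖ * σ x) -
        (3 / 5 * γ * ρ x ^ (5 / 3 : ℝ) - Z / ‖x‖ * ρ x)) +
      (σ x * (∫ y, ρ y / ‖x - y‖) - ρ x * ∫ y, ρ y / ‖x - y‖) := by
    filter_upwards [Measure.ae_ne volume 0] with x hx
    rw [h.equation x hx, bregman]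
    ring
  have iB : Integrable fun x => γ * bregman (σ x) (ρ x) :=
    ((iσ.sub iρ).add (iσV.sub iρV)).congr hB.symm
  have iB' : Integrable fun x => bregman (σ x) (ρ x) :=
    (iB.const_mul γ⁻¹).congr (Eventually.of_forall fun x => by simp only; field_simp)
  refine ⟨iB', ?_, ?_⟩
  · simp_rw [hQ]
    exact (hσ.2.2.sub iσρ).sub (iρσ.sub hρ.2.2)
  have e1 := integral_sub (hσ.2.2.sub iσρ) (iρσ.sub hρ.2.2)
  have e2 := integral_add (iσ.sub iρ) (iσV.sub iρV)
  simp only [Pi.sub_apply] at e1 e2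
  simp_rw [hQ]
  rw [e1, integral_sub hσ.2.2 iσρ, integral_sub iρσ hρ.2.2, eρσ, eσV, eρV, ← integral_const_mul,
    integral_congr_ae hB, e2, integral_sub iσ iρ, integral_sub iσV iρV,
    tfFunctional, tfFunctional, coulombEnergy_eq hσ.2.2, coulombEnergy_eq hρ.2.2, eρV]
  ring

theorem isTFMinimizer : IsTFMinimizer γ Z ρ := by
  refine ⟨h.mem_admissible hγ, fun σ hσ => ?_⟩
  obtain ⟨-, iQ, he⟩ := h.tfFunctional_sub hγ hσ
  have hB : 0 ≤ ∫ x, bregman (σ x) (ρ x) := integral_nonneg_of_ae <| by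
    filter_upwards [hσ.2.1] with x hx using (bregman_nonneg_and_eq hx (h.nonneg x)).1
  have hQ := integral_mul_mul_inv_norm_sub_nonneg (f := fun x => σ x - ρ x)
    (hσ.1.aestronglyMeasurable.sub h.measurable.aestronglyMeasurable) iQ
  have := mul_nonneg hγ.le hB
  linarith

theorem ae_eq_of_isTFMinimizer {σ : Space → ℝ} (hσ : IsTFMinimizer γ Z σ) : σ =ᵐ[volume] ρ := by
  obtain ⟨iB, iQ, he⟩ := h.tfFunctional_sub hγ hσ.1
  have hle := hσ.2 ρ (h.mem_admissible hγ)
  have hBnn : 0 ≤ᵐ[volume] fun x => bregman (σ x) (ρ x) := by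
    filter_upwards [hσ.1.2.1] with x hx using (bregman_nonneg_and_eq hx (h.nonneg x)).1
  have hB : 0 ≤ ∫ x, bregman (σ x) (ρ x) := integral_nonneg_of_ae hBnn
  have hQ := integral_mul_mul_inv_norm_sub_nonneg (f := fun x => σ x - ρ x)
    (hσ.1.1.aestronglyMeasurable.sub h.measurable.aestronglyMeasurable) iQ
  have h0 : ∫ x, bregman (σ x) (ρ x) = 0 := by
    refine le_antisymm ?_ hB
    by_contra! hpos
    have := mul_pos hγ hpos
    linarith
  filter_upwards [(integral_eq_zero_iff_of_nonneg_ae hBnn iB).1 h0, hσ.1.2.1] with x hx hx0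
  exact (bregman_nonneg_and_eq hx0 (h.nonneg x)).2 hx

end SolvesTF

/-! ### Scaling -/

/-- The Thomas-Fermi scaling of densities, which multiplies the nuclear charge by `a ^ 3`. -/
noncomputable def scale (a : ℝ) (ρ : Space → ℝ) (x : Space) : ℝ := a ^ 6 * ρ (a • x)

theorem scale_scale_inv {a : ℝ} (ha : a ≠ 0) (ρ : Space → ℝ) : scale a (scale a⁻¹ ρ) = ρ := by
  ext x
  unfold scale
  rw [smul_smul, inv_mul_cancel₀ ha, one_smul, ← mul_assoc, ← mul_pow, mul_inv_cancel₀ ha, one_pow,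
    one_mul]

theorem quasiMeasurePreserving_smul_space {a : ℝ} (ha : a ≠ 0) :
    Measure.QuasiMeasurePreserving (fun x : Space => a • x) volume volume := by
  refine ⟨by fun_prop, ?_⟩
  rw [Measure.map_addHaar_smul volume ha]
  exact Measure.smul_absolutelyContinuous

theorem scale_mem_admissible {a : ℝ} (ha : 0 < a) {ρ : Space → ℝ} (hρ : ρ ∈ admissible) :
    scale a ρ ∈ admissible := by
  have hq := quasiMeasurePreserving_smul_space ha.ne'
  have h1 := hρ.1.integrable_norm_rpow (by simp) (ENNReal.div_ne_top (by simp) (by simp))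
  refine ⟨MemLp.const_mul ?_ (a ^ 6), ?_, ?_⟩
  · have hm : AEStronglyMeasurable fun x => ρ (a • x) :=
      hρ.1.aestronglyMeasurable.comp_quasiMeasurePreserving hq
    rw [← integrable_norm_rpow_iff hm (by simp) (ENNReal.div_ne_top (by simp) (by simp))]
    exact h1.comp_smul ha.ne'
  · filter_upwards [hq.ae hρ.2.1] with x hx
    unfold scale
    positivity
  · refine ((hρ.2.2.comp_smul ha.ne').const_mul (a ^ 13)).congr (Eventually.of_forall fun p => ?_)
    simp only [scale, Prod.smul_fst, Prod.smul_snd, ← smul_sub, norm_smul, Real.norm_eq_abs,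
      abs_of_pos ha]
    field_simp

theorem integral_comp_smul_space {a : ℝ} (ha : 0 < a) (g : Space → ℝ) :
    ∫ x, g (a • x) = (a ^ 3)⁻¹ * ∫ x, g x := by
  rw [Measure.integral_comp_smul_of_nonneg volume g a (hR := ha.le)]
  simp

theorem tfFunctional_scale {a : ℝ} (ha : 0 < a) {ρ : Space → ℝ} (hρ : ρ ∈ admissible) (γ Z : ℝ) :
    tfFunctional γ (a ^ 3 * Z) (scale a ρ) = a ^ 7 * tfFunctional γ Z ρ := by
  have hq := quasiMeasurePreserving_smul_space ha.ne'
  have h1 : ∫ x, (3 / 5 * γ * scale a ρ x ^ (5 / 3 : ℝ) - a ^ 3 * Z / ‖x‖ * scale a ρ x) =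
      a ^ 7 * ∫ x, (3 / 5 * γ * ρ x ^ (5 / 3 : ℝ) - Z / ‖x‖ * ρ x) := by
    have h2 : (fun x => 3 / 5 * γ * scale a ρ x ^ (5 / 3 : ℝ) - a ^ 3 * Z / ‖x‖ * scale a ρ x)
        =ᵐ[volume] fun x => a ^ 10 *
          (3 / 5 * γ * ρ (a • x) ^ (5 / 3 : ℝ) - Z / ‖a • x‖ * ρ (a • x)) := by
      filter_upwards [hq.ae hρ.2.1] with x hx
      have h3 : (a ^ 6) ^ (5 / 3 : ℝ) = a ^ 10 := by
        rw [← Real.rpow_natCast_mul ha.le, ← Real.rpow_natCast]; norm_num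
      unfold scale
      rw [Real.mul_rpow (by positivity) hx, h3, norm_smul, Real.norm_eq_abs, abs_of_pos ha]
      field_simp
    rw [integral_congr_ae h2, integral_const_mul,
      integral_comp_smul_space ha fun x => 3 / 5 * γ * ρ x ^ (5 / 3 : ℝ) - Z / ‖x‖ * ρ x]
    field_simp
  have h2 : coulombEnergy (scale a ρ) = a ^ 7 * coulombEnergy ρ := by
    have h3 : ∀ x y : Space, scale a ρ x * scale a ρ y / ‖x - y‖ =
        a ^ 13 * (ρ (a • x) * ρ (a • y) / ‖a • x - a • y‖) := by
      intro x y
      rw [← smul_sub, norm_smul, Real.norm_eq_abs, abs_of_pos ha]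
      unfold scale
      field_simp
    unfold coulombEnergy
    simp_rw [h3, integral_const_mul]
    have h4 : ∀ x : Space, ∫ y, ρ (a • x) * ρ (a • y) / ‖a • x - a • y‖ =
        (a ^ 3)⁻¹ * ∫ y, ρ (a • x) * ρ y / ‖a • x - y‖ := fun x =>
      integral_comp_smul_space ha fun y => ρ (a • x) * ρ y / ‖a • x - y‖
    simp_rw [h4, integral_const_mul]
    rw [integral_comp_smul_space ha fun x => ∫ y, ρ x * ρ y / ‖x - y‖]
    field_simp
  rw [tfFunctional, h1, h2, tfFunctional]
  ring

theorem IsTFMinimizer.scale {a : ℝ} (ha : 0 < a) {γ Z : ℝ} {ρ : Space → ℝ}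
    (hρ : IsTFMinimizer γ Z ρ) : IsTFMinimizer γ (a ^ 3 * Z) (scale a ρ) := by
  refine ⟨scale_mem_admissible ha hρ.1, fun σ hσ => ?_⟩
  have hσ' := scale_mem_admissible (inv_pos.2 ha) hσ
  rw [← scale_scale_inv ha.ne' σ, tfFunctional_scale ha hρ.1, tfFunctional_scale ha hσ']
  have := hρ.2 _ hσ'
  gcongr

theorem tfEnergy_scale {a : ℝ} (ha : 0 < a) (γ Z : ℝ) :
    tfEnergy γ (a ^ 3 * Z) = a ^ 7 * tfEnergy γ Z := by
  have h1 : tfFunctional γ (a ^ 3 * Z) '' admissible =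
      a ^ 7 • (tfFunctional γ Z '' admissible) := by
    ext e
    simp only [mem_image, mem_smul_set, smul_eq_mul, exists_exists_and_eq_and]
    constructor
    · rintro ⟨σ, hσ, rfl⟩
      have hσ' := scale_mem_admissible (inv_pos.2 ha) hσ
      exact ⟨_, hσ', by rw [← tfFunctional_scale ha hσ', scale_scale_inv ha.ne']⟩
    · rintro ⟨σ, hσ, rfl⟩
      exact ⟨_, scale_mem_admissible ha hσ, tfFunctional_scale ha hσ γ Z⟩
  rw [tfEnergy, h1, Real.sInf_smul_of_nonneg (by positivity), tfEnergy, smul_eq_mul]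

theorem SolvesTF.tfEquation {γ Z : ℝ} {ρ σ : Space → ℝ} (h : SolvesTF γ Z ρ)
    (hσ : σ =ᵐ[volume] ρ) : ∀ᵐ x : Space,
      ConvolutionExistsAt σ coulombKernel x (ContinuousLinearMap.mul ℝ ℝ) volume ∧
      γ * σ x ^ (2 / 3 : ℝ) = tfPotential Z σ x := by
  filter_upwards [hσ, Measure.ae_ne volume 0] with x hx hx0
  have h1 : (fun y => ContinuousLinearMap.mul ℝ ℝ (σ y) (coulombKernel (x - y))) =ᵐ[volume]
      fun y => ρ y / ‖x - y‖ := by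
    filter_upwards [hσ] with y hy
    simp [hy, coulombKernel, div_eq_mul_inv]
  refine ⟨(h.integrable_potential x hx0).congr h1.symm, ?_⟩
  rw [tfPotential, convolution, integral_congr_ae h1, h.equation x hx0, hx, coulombKernel]
  ring

end ThomasFermi

theorem mainTheorem3 (γ : ℝ) (hγ : 0 < γ) :
    -- for every nuclear charge there is exactly one minimizer, up to null sets
    (∀ Z : ℝ, 0 < Z → ∃ ρ : ThomasFermi.Space → ℝ, ThomasFermi.IsTFMinimizer γ Z ρ ∧
      ∀ σ : ThomasFermi.Space → ℝ, ThomasFermi.IsTFMinimizer γ Z σ →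
        σ =ᵐ[MeasureTheory.volume] ρ) ∧
    -- its properties
    (∀ Z : ℝ, 0 < Z → ∀ ρ : ThomasFermi.Space → ℝ, ThomasFermi.IsTFMinimizer γ Z ρ →
      -- spherically symmetric, decreasing and convex in the radial variable
      (∃ f : ℝ → ℝ, AntitoneOn f (Set.Ioi 0) ∧ ConvexOn ℝ (Set.Ioi 0) f ∧
        ρ =ᵐ[MeasureTheory.volume] fun x => f ‖x‖) ∧
      -- total charge
      (MeasureTheory.Integrable ρ MeasureTheory.volume ∧ ∫ x, ρ x = Z) ∧
      -- Thomas-Fermi equation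
      (∀ᵐ x : ThomasFermi.Space,
        MeasureTheory.ConvolutionExistsAt ρ ThomasFermi.coulombKernel x
          (ContinuousLinearMap.mul ℝ ℝ) MeasureTheory.volume ∧
        γ * ρ x ^ (2 / 3 : ℝ) = ThomasFermi.tfPotential Z ρ x)) ∧
    -- scaling of the minimizer
    (∀ Z : ℝ, 0 < Z → ∀ ρ₁ ρZ : ThomasFermi.Space → ℝ,
      ThomasFermi.IsTFMinimizer γ 1 ρ₁ → ThomasFermi.IsTFMinimizer γ Z ρZ →
      ∀ᵐ x : ThomasFermi.Space, ρZ x = Z ^ 2 * ρ₁ (Z ^ (1 / 3 : ℝ) • x)) ∧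
    -- scaling of the energy
    (∀ Z : ℝ, 0 < Z →
      ThomasFermi.tfEnergy γ Z = ThomasFermi.tfEnergy γ 1 * Z ^ (7 / 3 : ℝ)) := by
  have hpow : ∀ Z : ℝ, 0 < Z → ∀ n : ℕ, (Z ^ (1 / 3 : ℝ)) ^ n = Z ^ (n / 3 : ℝ) := fun Z hZ n => by
    rw [← Real.rpow_mul_natCast hZ.le]
    congr 1
    ring
  have hcube : ∀ Z : ℝ, 0 < Z → (Z ^ (1 / 3 : ℝ)) ^ 3 = Z := fun Z hZ => by
    rw [hpow Z hZ]; norm_num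
  refine ⟨fun Z hZ => ?_, fun Z hZ ρ hρ => ?_, fun Z hZ ρ₁ ρZ h₁ hρZ => ?_, fun Z hZ => ?_⟩
  · obtain ⟨y, v, h⟩ := ThomasFermi.exists_isTFProfile (ThomasFermi.radialConst_pos hγ) hZ
    have hs := h.solvesTF hγ
    exact ⟨_, hs.isTFMinimizer hγ, fun σ hσ => hs.ae_eq_of_isTFMinimizer hγ hσ⟩
  · obtain ⟨y, v, h⟩ := ThomasFermi.exists_isTFProfile (ThomasFermi.radialConst_pos hγ) hZ
    have hs := h.solvesTF hγ
    have heq := hs.ae_eq_of_isTFMinimizer hγ hρ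
    exact ⟨⟨_, h.antitoneOn_radialDensity hγ, h.convexOn_radialDensity hγ, heq⟩,
      ⟨(h.integrable_radialDensity hγ).congr heq.symm,
        (integral_congr_ae heq).trans (h.integral_radialDensity hγ)⟩, hs.tfEquation heq⟩
  · obtain ⟨y, v, h⟩ := ThomasFermi.exists_isTFProfile (ThomasFermi.radialConst_pos hγ) hZ
    have hs := h.solvesTF hγ
    have h2 := h₁.scale (Real.rpow_pos_of_pos hZ (1 / 3))
    rw [hcube Z hZ, mul_one] at h2
    filter_upwards [hs.ae_eq_of_isTFMinimizer hγ hρZ, hs.ae_eq_of_isTFMinimizer hγ h2] with x hx hx'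
    rw [hx, ← hx', ThomasFermi.scale, hpow Z hZ]
    norm_num
  · have h1 := ThomasFermi.tfEnergy_scale (Real.rpow_pos_of_pos hZ (1 / 3)) γ 1
    rw [hcube Z hZ, mul_one, hpow Z hZ] at h1
    rw [h1, mul_comm]
    norm_num
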